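/- Let $\Gamma$ be a finite simple graph with vertex set $S$, $|S|\ge 2$, which is irreducible, i.e. not a join: its complement graph is connected. Let $W(\Gamma)$ be the right-angled Coxeter group generated by the involutions $s\in S$, where $s\neq t$ commute if they are adjacent in $\Gamma$ and $st$ has infinite order otherwise. Let $\mathcal B$ be a semi-regular right-angled building of type $\Gamma$ (a building of type $(W(\Gamma),S)$ with Weyl distance $\delta$, in which, for each $s$, all $s$-panels have the same, possibly infinite, cardinality $q_s\geq 2$). For each $s\in S$ let $\Omega_s$ be a set of cardinality $q_s$, and let $\lambda=(\lambda_s)_{s\in S}$ be a legal colouring of $\mathcal B$: each $\lambda_s$ is a map from the set of chambers to $\Omega_s$ which restricts to a bijection $\mathcal P\to\Omega_s$ on every $s$-panel $\mathcal P$ and is constant on every $t$-panel for $t\ne s$. For each $s$ let $F_s\le \mathrm{Sym}(\Omega_s)$ be a permutation group, and put $\mathbf F=(F_s)_{s\in S}$. Let $\mathcal U(\mathbf F)\le\mathrm{Aut}(\mathcal B)$ be the universal group: the group of all $\delta$-preserving permutations $g$ of the chambers such that for all $s\in S$ and all $s$-panels $\mathcal P$ the local action $\lambda_s|_{g\mathcal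 P}\circ g\circ(\lambda_s|_{\mathcal P})^{-1}$ belongs to $F_s$. Let $\mathcal U(\mathbf F)^+$ be the subgroup of $\mathcal U(\mathbf F)$ generated by the stabilizers of all chambers, and let $\mathcal U(\mathbf F)^\ddagger$ be the subgroup generated by the pointwise stabilizers of all tree-walls, i.e. of all residues of type $\{s\}\cup\{t: t \text{ adjacent to } s\}$, $s\in S$. Then: 1. $\mathcal U(\mathbf F)^+=\mathcal U(\mathbf F)^\ddagger$. 2. If not all $F_s$ act freely on $\Omega_s$, then $\mathcal U(\mathbf F)$ is monolithic (the intersection of all its non-trivial normal subgroups is non-trivial), this intersection, the monolith, is equal to $\mathcal U(\mathbf F)^+$, and $\mathcal U(\mathbf F)^+$ is simple. 3. In particular, suppose that every local action is infinite dihedral: $\mathbf F=\mathbf Y=(Y_s)_{s\in S}$, where $Y_s\le\mathrm{Sym}(\Omega_s)$ is isomorphic to the infinite dihedral group and contains, as a subgroup of index $2$, an infinite cyclic group acting regularly on $\Omega_s$. Then $\mathcal U(\mathbf Y)$ is monolithic, its monolith is $\mathcal U(\mathbf Y)^+$, the group $\mathcal U(\mathbf Y)^+$ is simple, and $\mathcal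 U(\mathbf Y)/\mathcal U(\mathbf Y)^+\cong W(\Gamma)$. -/

import Mathlib

universe u v w

/-! ### Buildings as `W`-metric spaces -/

/-- A building of type `M` with set of chambers `C`, given by its Weyl distance `δ` with values in
the Coxeter group of `M` (the standard `W`-metric definition of a building). -/
structure Building {S : Type v} (M : CoxeterMatrix S) (C : Type u) where
  nonempty : Nonempty C
  /-- the Weyl distance -/
  δ : C → C → M.Group
  δ_eq_one_iff : ∀ x y : C, δ x y = 1 ↔ x = y
  δ_of_adj : ∀ (s : S) (x y z : C), δ z x = M.simple s →
    δ z y = M.simple s * δ x y ∨ δ z y = δ x y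
  δ_of_adj_of_length_lt : ∀ (s : S) (x y z : C), δ z x = M.simple s →
    M.toCoxeterSystem.length (δ x y) < M.toCoxeterSystem.length (M.simple s * δ x y) →
    δ z y = M.simple s * δ x y
  exists_adj : ∀ (s : S) (x y : C), ∃ z : C, δ z x = M.simple s ∧ δ z y = M.simple s * δ x y

namespace Building

variable {S : Type v} {M : CoxeterMatrix S} {C : Type u} (B : Building M C)

/-- The `s`-panel containing the chamber `c`: all chambers `s`-adjacent or equal to `c`. -/
def panel (s : S) (c : C) : Set C := {d | B.δ c d = 1 ∨ B.δ c d = M.simple s}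

/-- The residue of type `J` containing the chamber `c`: all chambers whose Weyl distance from `c`
lies in the standard parabolic subgroup generated by `J`. -/
def residue (J : Set S) (c : C) : Set C := {d | B.δ c d ∈ Subgroup.closure (M.simple '' J)}

/-- The group of (type-preserving) automorphisms: the permutations of the set of chambers that
preserve the Weyl distance. -/
def aut : Subgroup (Equiv.Perm C) where
  carrier := {g | ∀ x y : C, B.δ (g x) (g y) = B.δ x y}
  mul_mem' := by
    intro a b ha hb x y
    exact (ha (b x) (b y)).trans (hb x y)
  one_mem' := fun _ _ => rfl
  inv_mem' := by
    intro a ha x y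
    have h := ha (a⁻¹ x) (a⁻¹ y)
    simpa using h.symm

theorem smul_mem_panel_iff (g : B.aut) (s : S) (c d : C) :
    g • d ∈ B.panel s (g • c) ↔ d ∈ B.panel s c := by
  have h : B.δ (g • c) (g • d) = B.δ c d := g.2 c d
  simp only [panel, Set.mem_ofPred_eq, h]

theorem self_mem_panel (s : S) (c : C) : c ∈ B.panel s c :=
  Or.inl ((B.δ_eq_one_iff c c).2 rfl)

/-- A legal colouring with colour sets `Ω s`: the colour `s` restricts to a bijection of every
`s`-panel with `Ω s`, and it is constant on the `t`-panels for `t ≠ s`. (In particular, all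
`s`-panels have the cardinality of `Ω s`, so a building with a legal colouring is semi-regular.) -/
structure LegalColouring (Ω : S → Type w) where
  colour : ∀ s : S, C → Ω s
  bijOn_panel : ∀ (s : S) (c : C), Set.BijOn (colour s) (B.panel s c) Set.univ
  constant_on_panel : ∀ s t : S, t ≠ s → ∀ c d : C, d ∈ B.panel t c → colour s d = colour s c

namespace LegalColouring

variable {B} {Ω : S → Type w} (col : B.LegalColouring Ω)

/-- The bijection of the `s`-panel of `c` with `Ω s` given by the colouring. -/
noncomputable def panelEquiv (s : S) (c : C) : B.panel s c ≃ Ω s :=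
  ((col.bijOn_panel s c).equiv (col.colour s)).trans (Equiv.Set.univ (Ω s))

@[simp] theorem panelEquiv_apply (s : S) (c : C) (d : B.panel s c) :
    col.panelEquiv s c d = col.colour s d := rfl

/-- The bijection from the `s`-panel of `c` to the `s`-panel of `g c` induced by `g`. -/
def panelMap (g : B.aut) (s : S) (c : C) : B.panel s c ≃ B.panel s (g • c) :=
  (MulAction.toPerm g).subtypeEquiv fun d => (B.smul_mem_panel_iff g s c d).symm

/-- The local action of the automorphism `g` at the `s`-panel `P` of `c`: the permutation
`λ_s|_{gP} ∘ g ∘ (λ_s|_P)⁻¹` of `Ω s`. -/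
noncomputable def localAction (g : B.aut) (s : S) (c : C) : Equiv.Perm (Ω s) :=
  ((col.panelEquiv s c).symm.trans (panelMap g s c)).trans (col.panelEquiv s (g • c))

theorem localAction_colour (g : B.aut) (s : S) (c d : C) (hd : d ∈ B.panel s c) :
    col.localAction g s c (col.colour s d) = col.colour s (g • d) := by
  have h : (col.panelEquiv s c).symm (col.colour s d) = ⟨d, hd⟩ := by
    rw [Equiv.symm_apply_eq]; rfl
  simp only [localAction, Equiv.trans_apply, h]
  rfl

theorem localAction_eq_iff (g : B.aut) (s : S) (c : C) (f : Equiv.Perm (Ω s)) :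
    col.localAction g s c = f ↔
      ∀ d ∈ B.panel s c, f (col.colour s d) = col.colour s (g • d) := by
  constructor
  · rintro rfl d hd
    exact col.localAction_colour g s c d hd
  · intro h
    ext a
    obtain ⟨d, hd, rfl⟩ := (col.bijOn_panel s c).surjOn (Set.mem_univ a)
    rw [h d hd, col.localAction_colour g s c d hd]

theorem localAction_one (s : S) (c : C) : col.localAction 1 s c = 1 := by
  rw [localAction_eq_iff]
  intro d _
  simp

theorem localAction_mul (g h : B.aut) (s : S) (c : C) :
    col.localAction (g * h) s c = col.localAction g s (h • c) * col.localAction h s c := by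
  rw [localAction_eq_iff]
  intro d hd
  rw [Equiv.Perm.mul_apply, col.localAction_colour h s c d hd,
    col.localAction_colour g s (h • c) (h • d) ((B.smul_mem_panel_iff h s c d).2 hd), mul_smul]

theorem localAction_inv (g : B.aut) (s : S) (c : C) :
    col.localAction g⁻¹ s c = (col.localAction g s (g⁻¹ • c))⁻¹ := by
  have h := col.localAction_mul g g⁻¹ s c
  rw [mul_inv_cancel, localAction_one] at h
  exact eq_inv_of_mul_eq_one_right h.symm

/-- The universal group `U(F)` with prescribed local actions `F s ≤ Sym(Ω s)`: all automorphisms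
whose local action at every `s`-panel belongs to `F s`, for all `s`. -/
def universalGroup (F : ∀ s : S, Subgroup (Equiv.Perm (Ω s))) : Subgroup B.aut where
  carrier := {g | ∀ (s : S) (c : C), col.localAction g s c ∈ F s}
  mul_mem' := by
    intro a b ha hb s c
    rw [localAction_mul]
    exact mul_mem (ha s _) (hb s c)
  one_mem' := by
    intro s c
    rw [localAction_one]
    exact one_mem _
  inv_mem' := by
    intro a ha s c
    rw [localAction_inv]
    exact inv_mem (ha s _)

/-- `U(F)⁺`: the subgroup of `U(F)` generated by all chamber stabilizers. -/
def plus (F : ∀ s : S, Subgroup (Equiv.Perm (Ω s))) : Subgroup (col.universalGroup F) :=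
  ⨆ c : C, MulAction.stabilizer (col.universalGroup F) c

instance plus_normal (F : ∀ s : S, Subgroup (Equiv.Perm (Ω s))) : (col.plus F).Normal := by
  constructor
  intro n hn g
  suffices h : col.plus F ≤ (col.plus F).comap (MulAut.conj g).toMonoidHom from h hn
  refine iSup_le fun c x hx => ?_
  refine Subgroup.mem_iSup_of_mem (g • c) ?_
  rw [MulAction.mem_stabilizer_iff] at hx ⊢
  simp [mul_smul, hx]

end LegalColouring

end Building

/-! ### Right-angled buildings -/

open Classical in
/-- The right-angled Coxeter matrix of a simple graph: `m_{st} = 2` if `s` and `t` are adjacent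
and `m_{st} = ∞` (encoded as `0`) if `s` and `t` are distinct and not adjacent. Its Coxeter group
is the right-angled Coxeter group `W(Γ)`. -/
noncomputable def SimpleGraph.coxeterMatrix {S : Type v} (Γ : SimpleGraph S) :
    CoxeterMatrix S where
  M := Matrix.of fun s t => if s = t then 1 else if Γ.Adj s t then 2 else 0
  isSymm := by
    ext s t
    simp [eq_comm, SimpleGraph.adj_comm]
  diagonal := by
    intro s
    simp
  off_diagonal := by
    intro s t h
    simp only [Matrix.of_apply, if_neg h]
    split_ifs <;> decide

/-- The `s`-tree-wall containing the chamber `c`: the residue of type `{s} ∪ s^⊥` containing `c`,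
where `s^⊥` is the set of neighbours of `s` in `Γ`. -/
def Building.treeWall {S : Type v} {Γ : SimpleGraph S} {C : Type u}
    (B : Building Γ.coxeterMatrix C) (s : S) (c : C) : Set C :=
  B.residue (insert s (Γ.neighborSet s)) c

/-- `U(F)^‡`: the subgroup of `U(F)` generated by the pointwise stabilizers of all tree-walls. -/
noncomputable def Building.LegalColouring.ddagger {S : Type v} {Γ : SimpleGraph S} {C : Type u}
    {B : Building Γ.coxeterMatrix C} {Ω : S → Type w} (col : B.LegalColouring Ω)
    (F : ∀ s : S, Subgroup (Equiv.Perm (Ω s))) : Subgroup (col.universalGroup F) :=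
  ⨆ (s : S) (c : C), fixingSubgroup (col.universalGroup F) (B.treeWall s c)

/-! ### Group-theoretic notions -/

/-- The intersection of all non-trivial normal subgroups of a group. -/
def monolith (G : Type u) [Group G] : Subgroup G :=
  sInf {N : Subgroup G | N.Normal ∧ N ≠ ⊥}

/-- A group is monolithic if the intersection of all its non-trivial normal subgroups is
non-trivial. -/
def IsMonolithic (G : Type u) [Group G] : Prop := monolith G ≠ ⊥

/-- A permutation group acts freely if only the identity fixes a point. -/
def Subgroup.ActsFreely {X : Type w} (F : Subgroup (Equiv.Perm X)) : Prop :=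
  ∀ f ∈ F, ∀ x : X, f x = x → f = 1

/-- An infinite dihedral local action: a subgroup of `Sym(X)` isomorphic to the infinite dihedral
group which contains, with index two, an infinite cyclic group acting regularly on `X`. -/
def Subgroup.IsInfiniteDihedralAction {X : Type w} (Y : Subgroup (Equiv.Perm X)) : Prop :=
  Nonempty (Y ≃* DihedralGroup 0) ∧
  ∃ Z : Subgroup (Equiv.Perm X), IsCyclic Z ∧ Infinite Z ∧ (∀ x y : X, ∃! f : Z, f • x = y) ∧
    Z ≤ Y ∧ Z.relIndex Y = 2

/-! ### Right-angled Coxeter groups -/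

namespace CoxeterMatrix

variable {S : Type v} (M : CoxeterMatrix S)

/-! Automorphisms come from colourings. In a right-angled Coxeter group two descents of one element
commute, so a map can be developed along reduced galleries from a base chamber (`develops_unique`).
Consequently two legal colourings that match at the base differ by an automorphism (`exists_aut`),
and an element of U(F) fixing a chamber c is a product of elements of U(F) fixing c that each change
the colours of a single type (`mem_of_single_colour`). A factor of type r fixes pointwise the
tree-wall through c of any type q ≠ r not adjacent to r, and irreducibility provides such a q. This
gives U(F)⁺ = U(F)^‡.

For simplicity, call the complement of a wing a half-space. An element fixing the boundary of a
half-space may be replaced by the identity on one side (`exists_glue`), so chamber stabilizers are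
generated by elements supported in half-spaces. Let N ≠ 1 be normalized by them. Some n₀ in N moves
a tree-wall of type s, where F_s is not free. A permutation in F_s that fixes one colour and moves
another yields chamber-fixing elements that push half-spaces off themselves (`exists_flip`).
Ping-pong with such a k produces n = [n₀, k] in N and a half-space whose translates under the powers
of n are disjoint (`exists_half_space_le`). An infinite product of conjugates then writes each
element supported there as a commutator [h, n] with h fixing a chamber, so it lies in N
(`mem_of_wandering`). Flips carry every other half-space into this one (`mem_of_fixes_wing`), and
hence N contains U(F)⁺.

For infinite dihedral actions, the colours of each type are identified with ℤ, and only their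
parities matter. Parity folds the building onto W(Γ): crossing an s-panel multiplies by s exactly
when the parity changes (`exists_folding`). The folding turns U(F) into a group of left
multiplications and kills chamber stabilizers. Odd translations give the inverse map from W(Γ) to
the quotient (`nonempty_quotient_mulEquiv`). -/

theorem simple_mul_self (s : S) : M.simple s * M.simple s = 1 :=
  M.toCoxeterSystem.simple_mul_simple_self s

theorem simple_inv (s : S) : (M.simple s)⁻¹ = M.simple s :=
  M.toCoxeterSystem.inv_simple s

theorem simple_mul_cancel_left (s : S) (w : M.Group) : M.simple s * (M.simple s * w) = w :=
  M.toCoxeterSystem.simple_mul_simple_cancel_left s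

theorem simple_mul_cancel_right (s : S) (w : M.Group) : w * M.simple s * M.simple s = w :=
  M.toCoxeterSystem.simple_mul_simple_cancel_right s

theorem simple_ne_one (s : S) : M.simple s ≠ 1 := by
  intro h
  have h1 := M.toCoxeterSystem.length_simple s
  rw [M.toCoxeterSystem_simple, h, M.toCoxeterSystem.length_one] at h1
  exact zero_ne_one h1

end CoxeterMatrix

namespace SimpleGraph

variable {S : Type v} (Γ : SimpleGraph S)

/-- The standard Coxeter system of the right-angled Coxeter group of `Γ`. -/
noncomputable abbrev cs : CoxeterSystem Γ.coxeterMatrix Γ.coxeterMatrix.Group :=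
  Γ.coxeterMatrix.toCoxeterSystem

local notation "σ" => CoxeterMatrix.simple (SimpleGraph.coxeterMatrix Γ)
local notation "ℓ" => CoxeterSystem.length (SimpleGraph.cs Γ)

open Classical in
theorem coxeterMatrix_apply_of_adj {s t : S} (h : Γ.Adj s t) : Γ.coxeterMatrix s t = 2 := by
  change (if s = t then 1 else if Γ.Adj s t then 2 else 0) = 2
  rw [if_neg h.ne, if_pos h]

open Classical in
theorem coxeterMatrix_apply_of_not_adj {s t : S} (hne : s ≠ t) (h : ¬ Γ.Adj s t) :
    Γ.coxeterMatrix s t = 0 := by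
  change (if s = t then 1 else if Γ.Adj s t then 2 else 0) = 0
  rw [if_neg hne, if_neg h]

theorem simple_comm {s t : S} (h : Γ.Adj s t) : σ s * σ t = σ t * σ s := by
  have h1 := Γ.cs.simple_mul_simple_pow s t
  rw [Γ.coxeterMatrix_apply_of_adj h, pow_two] at h1
  have h2 := eq_inv_of_mul_eq_one_left h1
  rw [mul_inv_rev] at h2
  simpa [CoxeterMatrix.simple_inv] using h2

theorem isLiftable {G : Type*} [Monoid G] (f : S → G) (h1 : ∀ s, f s * f s = 1)
    (h2 : ∀ s t, Γ.Adj s t → f s * f t = f t * f s) : Γ.coxeterMatrix.IsLiftable f := by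
  intro s t
  by_cases hst : s = t
  · subst hst
    rw [h1, one_pow]
  by_cases ha : Γ.Adj s t
  · rw [Γ.coxeterMatrix_apply_of_adj ha, pow_two]
    nth_rw 2 [h2 s t ha]
    rw [mul_assoc, ← mul_assoc (f t), h1, one_mul, h1]
  · rw [Γ.coxeterMatrix_apply_of_not_adj hst ha, pow_zero]

/-- The homomorphism from the right-angled Coxeter group determined by the images of the
generators. -/
noncomputable def liftHom {G : Type*} [Monoid G] (f : S → G) (h1 : ∀ s, f s * f s = 1)
    (h2 : ∀ s t, Γ.Adj s t → f s * f t = f t * f s) : Γ.coxeterMatrix.Group →* G :=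
  Γ.cs.lift ⟨f, Γ.isLiftable f h1 h2⟩

@[simp] theorem liftHom_simple {G : Type*} [Monoid G] (f : S → G) (h1 : ∀ s, f s * f s = 1)
    (h2 : ∀ s t, Γ.Adj s t → f s * f t = f t * f s) (s : S) :
    Γ.liftHom f h1 h2 (σ s) = f s :=
  Γ.cs.lift_apply_simple _ s

open Classical in
/-- The parity of the number of occurrences of the letter `s`. -/
noncomputable def letterParity (s : S) : Γ.coxeterMatrix.Group →* Multiplicative (ZMod 2) :=
  Γ.liftHom (fun t => if t = s then Multiplicative.ofAdd 1 else 1)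
    (by intro t; split_ifs <;> decide) (fun _ _ _ => mul_comm _ _)

theorem letterParity_self (s : S) : Γ.letterParity s (σ s) = Multiplicative.ofAdd 1 := by
  simp [letterParity]

theorem letterParity_of_ne {s t : S} (h : t ≠ s) : Γ.letterParity s (σ t) = 1 := by
  simp [letterParity, h]

theorem simple_injective : Function.Injective Γ.coxeterMatrix.simple := by
  intro s t h
  by_contra hne
  have h1 := Γ.letterParity_self s
  rw [h, Γ.letterParity_of_ne (Ne.symm hne)] at h1
  exact absurd h1 (by decide)

open Classical in
-- Killing all other generators maps W(Γ) to the infinite dihedral group `DihedralGroup 0`, where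
-- the product of the two reflections is a rotation of infinite order.
theorem simple_mul_simple_zpow_ne_one {s t : S} (hne : s ≠ t) (h : ¬ Γ.Adj s t) {n : ℤ}
    (hn : n ≠ 0) : (σ s * σ t) ^ n ≠ 1 := by
  intro h0
  let f : S → DihedralGroup 0 := fun r =>
    if r = s then DihedralGroup.sr 0 else if r = t then DihedralGroup.sr 1 else 1
  have hf1 : ∀ r, f r * f r = 1 := by
    intro r
    simp only [f]
    split_ifs <;> simp
  have hf2 : ∀ r r', Γ.Adj r r' → f r * f r' = f r' * f r := by
    intro r r' hr
    have hrr := hr.ne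
    simp only [f]
    split_ifs with h1 h2 h3 h4 h5 h6 h7 h8 <;> subst_vars <;>
      first | rfl | (exact absurd hr h) | (exact absurd hr.symm h)
  have h2 := congrArg (Γ.liftHom f hf1 hf2) h0
  rw [map_zpow, map_mul, liftHom_simple, liftHom_simple, map_one] at h2
  have h3 : f s * f t = DihedralGroup.r 1 := by
    simp [f, hne.symm]
  rw [h3, DihedralGroup.r_zpow, DihedralGroup.one_def] at h2
  have h4 := DihedralGroup.r.inj h2
  exact hn (by simpa using h4)

/-! The reflection cocycle and strong exchange. -/

open Classical in
/-- The indicator function of a generator. -/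
noncomputable def simpleIndicator (s : S) (r : Γ.coxeterMatrix.Group) : ZMod 2 :=
  if r = σ s then 1 else 0

theorem simpleIndicator_self (s : S) : Γ.simpleIndicator s (σ s) = 1 := if_pos rfl

open Classical in
theorem simpleIndicator_congr {s : S} {r r' : Γ.coxeterMatrix.Group} (h : r = σ s ↔ r' = σ s) :
    Γ.simpleIndicator s r = Γ.simpleIndicator s r' := by
  unfold simpleIndicator
  exact if_congr h rfl rfl

/-- The signed conjugation action of a generator on group elements. -/
noncomputable def signedConj (s : S) (p : Γ.coxeterMatrix.Group × ZMod 2) :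
    Γ.coxeterMatrix.Group × ZMod 2 :=
  (σ s * p.1 * σ s, p.2 + Γ.simpleIndicator s p.1)

theorem signedConj_mul_self (s : S) : Γ.signedConj s ∘ Γ.signedConj s = id := by
  funext p
  rcases p with ⟨r, e⟩
  have h2 : σ s * r * σ s = σ s ↔ r = σ s := by
    constructor
    · intro h
      have := congrArg (fun x => σ s * x * σ s) h
      simpa [mul_assoc, CoxeterMatrix.simple_mul_cancel_left,
        CoxeterMatrix.simple_mul_self] using this
    · rintro rfl
      rw [CoxeterMatrix.simple_mul_self, one_mul]
  change signedConj Γ s (signedConj Γ s (r, e)) = (r, e)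
  simp only [signedConj, Γ.simpleIndicator_congr h2, Prod.mk.injEq]
  constructor
  · simp [mul_assoc, CoxeterMatrix.simple_mul_cancel_left, CoxeterMatrix.simple_mul_self]
  · rw [add_assoc, CharTwo.add_self_eq_zero, add_zero]

theorem simple_conj_eq_simple_iff {s t : S} (hst : Γ.Adj s t) (r : Γ.coxeterMatrix.Group) :
    σ t * r * σ t = σ s ↔ r = σ s := by
  have hc := Γ.simple_comm hst
  constructor
  · intro h
    have := congrArg (fun x => σ t * x * σ t) h
    rw [← hc, CoxeterMatrix.simple_mul_cancel_right] at this
    simpa [mul_assoc, CoxeterMatrix.simple_mul_cancel_left,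
      CoxeterMatrix.simple_mul_self] using this
  · rintro rfl
    rw [← hc, CoxeterMatrix.simple_mul_cancel_right]

theorem signedConj_comm {s t : S} (hst : Γ.Adj s t) :
    Γ.signedConj s ∘ Γ.signedConj t = Γ.signedConj t ∘ Γ.signedConj s := by
  have hc := Γ.simple_comm hst
  funext p
  rcases p with ⟨r, e⟩
  change signedConj Γ s (signedConj Γ t (r, e)) = signedConj Γ t (signedConj Γ s (r, e))
  simp only [signedConj, Γ.simpleIndicator_congr (Γ.simple_conj_eq_simple_iff hst r),
    Γ.simpleIndicator_congr (Γ.simple_conj_eq_simple_iff hst.symm r), Prod.mk.injEq]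
  constructor
  · calc σ s * (σ t * r * σ t) * σ s = (σ s * σ t) * r * (σ t * σ s) := by group
      _ = (σ t * σ s) * r * (σ s * σ t) := by rw [hc]
      _ = _ := by group
  · ring

/-- The signed conjugation action of the Coxeter group. -/
noncomputable def signedConjHom :
    Γ.coxeterMatrix.Group →* Function.End (Γ.coxeterMatrix.Group × ZMod 2) :=
  Γ.liftHom (G := Function.End (Γ.coxeterMatrix.Group × ZMod 2)) Γ.signedConj
    Γ.signedConj_mul_self fun _ _ => Γ.signedConj_comm

theorem signedConjHom_simple (s : S) : Γ.signedConjHom (σ s) = Γ.signedConj s :=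
  Γ.liftHom_simple _ _ _ s

/-- The reflection cocycle: for a reflection `r`, it is non-zero if and only if
`w r` is shorter than `w`. -/
noncomputable def reflCocycle (w r : Γ.coxeterMatrix.Group) : ZMod 2 :=
  (Γ.signedConjHom w (r, 0)).2

theorem signedConjHom_apply (w r : Γ.coxeterMatrix.Group) (e : ZMod 2) :
    Γ.signedConjHom w (r, e) = (w * r * w⁻¹, e + Γ.reflCocycle w r) := by
  revert r e
  refine Γ.cs.simple_induction_left (p := fun w => ∀ r e,
    Γ.signedConjHom w (r, e) = (w * r * w⁻¹, e + Γ.reflCocycle w r)) w ?_ ?_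
  · intro r e
    simp [reflCocycle, Function.End.one_def]
  · intro w i ih r e
    have h1 : ∀ e, Γ.signedConjHom (Γ.cs.simple i * w) (r, e) =
        Γ.signedConj i (Γ.signedConjHom w (r, e)) := by
      intro e
      rw [map_mul]
      change Γ.signedConjHom (σ i) _ = _
      rw [signedConjHom_simple]
    rw [reflCocycle, h1, h1, ih, ih]
    simp only [signedConj, mul_inv_rev, Prod.mk.injEq]
    constructor
    · rw [CoxeterMatrix.toCoxeterSystem_simple, CoxeterMatrix.simple_inv]; group
    · ring

theorem reflCocycle_mul (a b r : Γ.coxeterMatrix.Group) :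
    Γ.reflCocycle (a * b) r = Γ.reflCocycle b r + Γ.reflCocycle a (b * r * b⁻¹) := by
  have h := congrArg Prod.snd (Γ.signedConjHom_apply (a * b) r 0)
  rw [map_mul] at h
  change (Γ.signedConjHom a (Γ.signedConjHom b (r, 0))).2 = _ at h
  rw [signedConjHom_apply, signedConjHom_apply] at h
  simpa using h.symm

theorem reflCocycle_simple (s : S) (r : Γ.coxeterMatrix.Group) :
    Γ.reflCocycle (σ s) r = Γ.simpleIndicator s r := by
  rw [reflCocycle, signedConjHom_simple]
  simp [signedConj]

theorem reflCocycle_one (r : Γ.coxeterMatrix.Group) : Γ.reflCocycle 1 r = 0 := by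
  simp [reflCocycle, Function.End.one_def]

open Classical in
-- The cocycle counts modulo 2 how often `r` occurs in the inversion sequence of any word for the
-- element, so a non-zero value forces an occurrence.
theorem mem_rightInvSeq_of_reflCocycle_ne_zero (ω : List S) (r : Γ.coxeterMatrix.Group)
    (h : Γ.reflCocycle (Γ.cs.wordProd ω) r ≠ 0) : r ∈ Γ.cs.rightInvSeq ω := by
  induction ω with
  | nil => exact absurd (Γ.reflCocycle_one r) (by simpa using h)
  | cons i ω ih =>
    rw [CoxeterSystem.wordProd_cons, reflCocycle_mul, CoxeterMatrix.toCoxeterSystem_simple,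
      reflCocycle_simple, simpleIndicator] at h
    rw [CoxeterSystem.rightInvSeq, List.mem_cons]
    split_ifs at h with h1
    · left
      rw [CoxeterMatrix.toCoxeterSystem_simple, ← h1]
      group
    · right
      exact ih (by simpa using h)

theorem length_mul_lt_of_reflCocycle_ne_zero {w r : Γ.coxeterMatrix.Group}
    (h : Γ.reflCocycle w r ≠ 0) : ℓ (w * r) < ℓ w := by
  obtain ⟨ω, hω, rfl⟩ := Γ.cs.exists_isReduced w
  exact (Γ.cs.isRightInversion_of_mem_rightInvSeq hω
    (Γ.mem_rightInvSeq_of_reflCocycle_ne_zero ω r h)).2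

theorem isRightDescent_iff_reflCocycle {w : Γ.coxeterMatrix.Group} {s : S} :
    Γ.cs.IsRightDescent w s ↔ Γ.reflCocycle w (σ s) ≠ 0 := by
  constructor
  · intro h h0
    have h1 : Γ.reflCocycle (w * σ s) (σ s) ≠ 0 := by
      rw [reflCocycle_mul, reflCocycle_simple, CoxeterMatrix.simple_inv,
        CoxeterMatrix.simple_mul_cancel_right, h0, simpleIndicator_self]
      decide
    have h2 := Γ.length_mul_lt_of_reflCocycle_ne_zero h1
    rw [CoxeterMatrix.simple_mul_cancel_right] at h2
    exact absurd h (not_lt.2 h2.le)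
  · exact Γ.length_mul_lt_of_reflCocycle_ne_zero

end SimpleGraph

/-! ### Descents and parabolic subgroups in the right-angled case. -/

namespace SimpleGraph

variable {S : Type v} (Γ : SimpleGraph S)

local notation "σ" => CoxeterMatrix.simple (SimpleGraph.coxeterMatrix Γ)
local notation "ℓ" => CoxeterSystem.length (SimpleGraph.cs Γ)
local notation "LD" => CoxeterSystem.IsLeftDescent (SimpleGraph.cs Γ)
local notation "RD" => CoxeterSystem.IsRightDescent (SimpleGraph.cs Γ)

/-- The standard parabolic subgroup generated by `J`. -/
noncomputable abbrev parabolic (J : Set S) : Subgroup Γ.coxeterMatrix.Group :=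
  Subgroup.closure (Γ.coxeterMatrix.simple '' J)

theorem simple_mem_parabolic {J : Set S} {s : S} (h : s ∈ J) : σ s ∈ Γ.parabolic J :=
  Subgroup.subset_closure ⟨s, h, rfl⟩

theorem simple_mem_parabolic_iff {J : Set S} {s : S} : σ s ∈ Γ.parabolic J ↔ s ∈ J := by
  refine ⟨fun h => ?_, Γ.simple_mem_parabolic⟩
  by_contra hs
  have h1 : Γ.parabolic J ≤ (Γ.letterParity s).ker := by
    rw [Subgroup.closure_le]
    rintro _ ⟨t, ht, rfl⟩
    exact Γ.letterParity_of_ne (by rintro rfl; exact hs ht)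
  have h2 : Γ.letterParity s (σ s) = 1 := h1 h
  rw [Γ.letterParity_self] at h2
  exact absurd h2 (by decide)

theorem parabolic_mono {J K : Set S} (h : J ⊆ K) : Γ.parabolic J ≤ Γ.parabolic K :=
  Subgroup.closure_mono (Set.image_mono h)

/-- This holds for a generator in `J`, and the cocycle rule propagates it to products and inverses,
since conjugation by W_J preserves W_J. It shows that elements of W_J have descents in `J` only. -/
theorem mem_parabolic_of_reflCocycle_ne_zero {J : Set S} {w : Γ.coxeterMatrix.Group}
    (hw : w ∈ Γ.parabolic J) : ∀ r, Γ.reflCocycle w r ≠ 0 → r ∈ Γ.parabolic J := by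
  have hconj : ∀ b ∈ Γ.parabolic J, ∀ r, b * r * b⁻¹ ∈ Γ.parabolic J → r ∈ Γ.parabolic J := by
    intro b hb r hr
    have := mul_mem (mul_mem (inv_mem hb) hr) hb
    simpa [mul_assoc] using this
  induction hw using Subgroup.closure_induction with
  | mem x hx =>
    obtain ⟨s, hs, rfl⟩ := hx
    intro r hr
    rw [reflCocycle_simple, simpleIndicator] at hr
    split_ifs at hr with h
    · rw [h]; exact Γ.simple_mem_parabolic hs
    · exact absurd rfl hr
  | one => intro r hr; exact absurd (Γ.reflCocycle_one r) hr
  | mul a b ha hb iha ihb =>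
    intro r hr
    rw [reflCocycle_mul] at hr
    by_cases h : Γ.reflCocycle b r = 0
    · rw [h, zero_add] at hr
      exact hconj b hb r (iha _ hr)
    · exact ihb r h
  | inv a ha iha =>
    intro r hr
    have h := Γ.reflCocycle_mul a a⁻¹ r
    rw [mul_inv_cancel, reflCocycle_one] at h
    have h2 : Γ.reflCocycle a (a⁻¹ * r * a⁻¹⁻¹) ≠ 0 := by
      intro h0
      rw [h0, add_zero] at h
      exact hr h.symm
    exact hconj a⁻¹ (inv_mem ha) r (iha _ h2)

theorem not_isRightDescent_of_mem_parabolic {J : Set S} {w : Γ.coxeterMatrix.Group}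
    (hw : w ∈ Γ.parabolic J) {r : S} (hr : r ∉ J) : ¬ RD w r := fun h =>
  hr (Γ.simple_mem_parabolic_iff.1
    (Γ.mem_parabolic_of_reflCocycle_ne_zero hw _ (Γ.isRightDescent_iff_reflCocycle.1 h)))

theorem not_isLeftDescent_of_mem_parabolic {J : Set S} {w : Γ.coxeterMatrix.Group}
    (hw : w ∈ Γ.parabolic J) {r : S} (hr : r ∉ J) : ¬ LD w r := by
  rw [← CoxeterSystem.isRightDescent_inv_iff]
  exact Γ.not_isRightDescent_of_mem_parabolic (inv_mem hw) hr

/-- Otherwise s and t generate an infinite dihedral group, whose reflections `ρ n` are indexed by ℤ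
with s at 0 and t at -1. The inversions of w among them form an interval on one side of the cut
between -1 and 0, so they cannot include both s and t. -/
theorem adj_of_isRightDescent {s t : S} (hne : s ≠ t) {w : Γ.coxeterMatrix.Group}
    (hs : RD w s) (ht : RD w t) : Γ.Adj s t := by
  by_contra hadj
  let ρ : ℤ → Γ.coxeterMatrix.Group := fun n => (σ s * σ t) ^ n * σ s
  have hx := fun n hn => Γ.simple_mul_simple_zpow_ne_one hne hadj (n := n) hn
  have conj_s : ∀ n : ℤ, σ s * (σ s * σ t) ^ n * σ s = (σ s * σ t) ^ (-n) := by
    intro n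
    have h := conj_zpow (i := n) (a := σ s) (b := σ s * σ t)
    rw [CoxeterMatrix.simple_inv] at h
    rw [← h, zpow_neg, ← inv_zpow, mul_inv_rev, CoxeterMatrix.simple_inv,
      CoxeterMatrix.simple_inv, CoxeterMatrix.simple_mul_cancel_left]
  have conj_t : ∀ n : ℤ, σ t * (σ s * σ t) ^ n * σ t = (σ s * σ t) ^ (-n) := by
    intro n
    have h := conj_zpow (i := n) (a := σ t) (b := σ s * σ t)
    rw [CoxeterMatrix.simple_inv] at h
    rw [← h, zpow_neg, ← inv_zpow, mul_inv_rev, CoxeterMatrix.simple_inv,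
      CoxeterMatrix.simple_inv, ← mul_assoc, CoxeterMatrix.simple_mul_cancel_right]
  have ρ0 : ρ 0 = σ s := by simp [ρ]
  have ρ1 : ρ (-1) = σ t := by
    simp [ρ, mul_inv_rev, CoxeterMatrix.simple_inv, CoxeterMatrix.simple_mul_cancel_right]
  have ρinj : ∀ m n, ρ m = ρ n → m = n := by
    intro m n h
    by_contra hmn
    have h1 := mul_right_cancel h
    exact hx (m - n) (sub_ne_zero.2 hmn) (by rw [zpow_sub, h1, mul_inv_cancel])
  have hρs : ∀ n, σ s * ρ n * (σ s)⁻¹ = ρ (-n) := by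
    intro n
    simp only [ρ, ← conj_s, CoxeterMatrix.simple_inv, mul_assoc]
  have hρt : ∀ n, σ t * ρ n * (σ t)⁻¹ = ρ (-2 - n) := by
    intro n
    have h1 : σ t * ρ n * (σ t)⁻¹ = σ t * (σ s * σ t) ^ (n + 1) * σ t * σ t := by
      rw [CoxeterMatrix.simple_mul_cancel_right, zpow_add_one, CoxeterMatrix.simple_inv]
      simp only [ρ, mul_assoc]
    rw [h1, conj_t, show -(n + 1) = (-2 - n) + 1 by ring, zpow_add_one]
    simp only [ρ, mul_assoc, CoxeterMatrix.simple_mul_self, mul_one]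
  have hρmem : ∀ n, ρ n ∈ Γ.parabolic {s, t} := fun n =>
    mul_mem (zpow_mem (mul_mem (Γ.simple_mem_parabolic (by simp))
      (Γ.simple_mem_parabolic (by simp))) n) (Γ.simple_mem_parabolic (by simp))
  -- The inversions are `[0, k)` or `[k, 0)`. Multiplying by s reflects n to -n and toggles 0;
  -- multiplying by t reflects n to -2 - n and toggles -1. Both preserve this form.
  let shape : Γ.coxeterMatrix.Group → Prop := fun v => ∃ k : ℤ, ∀ n : ℤ,
    Γ.reflCocycle v (ρ n) ≠ 0 ↔ (0 ≤ n ∧ n < k) ∨ (k ≤ n ∧ n < 0)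
  have flip : ∀ x : ZMod 2, 1 + x ≠ 0 ↔ ¬ x ≠ 0 := by decide
  have shape_s : ∀ v, shape v → shape (v * σ s) := by
    rintro v ⟨k, hk⟩
    refine ⟨1 - k, fun n => ?_⟩
    rw [reflCocycle_mul, reflCocycle_simple, hρs]
    by_cases hn : n = 0
    · rw [hn, ρ0, simpleIndicator_self, flip, neg_zero, hk]; lia
    · rw [simpleIndicator, if_neg (by rw [← ρ0]; exact fun h => hn (ρinj _ _ h)), zero_add, hk]
      lia
  have shape_t : ∀ v, shape v → shape (v * σ t) := by
    rintro v ⟨k, hk⟩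
    refine ⟨-1 - k, fun n => ?_⟩
    rw [reflCocycle_mul, reflCocycle_simple, hρt]
    by_cases hn : n = -1
    · rw [hn, ρ1, simpleIndicator_self, flip, show (-2 - -1 : ℤ) = -1 by ring, hk]; lia
    · rw [simpleIndicator, if_neg (by rw [← ρ1]; exact fun h => hn (ρinj _ _ h)), zero_add, hk]
      lia
  -- A shortest element of the coset of the dihedral subgroup has no inversion among the `ρ n`, so
  -- its interval is empty; w is reached from it by multiplying by s and t.
  obtain ⟨a, ha, hmin⟩ : ∃ a ∈ Γ.parabolic {s, t}, ∀ b ∈ Γ.parabolic {s, t},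
      ℓ (w * a) ≤ ℓ (w * b) := by
    have hne : (Γ.parabolic {s, t} : Set Γ.coxeterMatrix.Group).Nonempty := ⟨1, one_mem _⟩
    obtain ⟨a, ha, h⟩ := WellFounded.has_min (measure fun a => ℓ (w * a)).wf _ hne
    exact ⟨a, ha, fun b hb => not_lt.1 (h b hb)⟩
  have hu : shape (w * a) := by
    refine ⟨0, fun n => ?_⟩
    have h0 : Γ.reflCocycle (w * a) (ρ n) = 0 := by
      by_contra h
      have h1 := Γ.length_mul_lt_of_reflCocycle_ne_zero h
      rw [mul_assoc] at h1
      exact absurd (hmin _ (mul_mem ha (hρmem n))) (not_le.2 h1)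
    simp only [h0, ne_eq, not_true_eq_false, false_iff]
    lia
  have hall : ∀ b ∈ Γ.parabolic {s, t}, shape (w * a * b) := by
    intro b hb
    have hgen : ∀ x ∈ Γ.coxeterMatrix.simple '' {s, t}, ∀ v, shape v → shape (v * x) := by
      rintro _ ⟨r, hr, rfl⟩
      rcases hr with rfl | hr
      · exact shape_s
      · rw [Set.mem_singleton_iff.1 hr]; exact shape_t
    induction hb using Subgroup.closure_induction_right with
    | one => rwa [mul_one]
    | mul_right x hx y hy ih => rw [← mul_assoc]; exact hgen y hy _ ih
    | mul_inv_cancel x hx y hy ih =>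
      obtain ⟨r, hr, rfl⟩ := hy
      rw [← mul_assoc, CoxeterMatrix.simple_inv]
      exact hgen _ ⟨r, hr, rfl⟩ _ ih
  obtain ⟨k, hk⟩ := hall a⁻¹ (inv_mem ha)
  rw [mul_inv_cancel_right] at hk
  have h1 := (hk 0).1 (by rw [ρ0]; exact Γ.isRightDescent_iff_reflCocycle.1 hs)
  have h2 := (hk (-1)).1 (by rw [ρ1]; exact Γ.isRightDescent_iff_reflCocycle.1 ht)
  lia

theorem adj_of_isLeftDescent {s t : S} (hne : s ≠ t) {w : Γ.coxeterMatrix.Group}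
    (hs : LD w s) (ht : LD w t) : Γ.Adj s t := by
  rw [← CoxeterSystem.isRightDescent_inv_iff] at hs ht
  exact Γ.adj_of_isRightDescent hne hs ht

theorem isRightDescent_mul_simple_iff {s t : S} (h : Γ.Adj s t) (w : Γ.coxeterMatrix.Group) :
    RD (w * σ t) s ↔ RD w s := by
  rw [isRightDescent_iff_reflCocycle, isRightDescent_iff_reflCocycle, reflCocycle_mul,
    reflCocycle_simple, simpleIndicator, if_neg fun h' => h.ne (Γ.simple_injective h'), zero_add,
    ← Γ.simple_comm h, CoxeterMatrix.simple_inv, CoxeterMatrix.simple_mul_cancel_right]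

/-- The exchange condition: left multiplication by s changes the cocycle only at the reflection that
w conjugates to s. -/
theorem simple_mul_eq_of_isRightDescent {s t : S} {w : Γ.coxeterMatrix.Group} (h1 : ¬ RD w t)
    (h2 : RD (σ s * w) t) : σ s * w = w * σ t := by
  rw [isRightDescent_iff_reflCocycle, not_not] at h1
  rw [isRightDescent_iff_reflCocycle, reflCocycle_mul, h1, zero_add, reflCocycle_simple,
    simpleIndicator] at h2
  split_ifs at h2 with h
  · rw [← h]; group
  · exact absurd rfl h2

theorem simple_mul_eq_of_isLeftDescent {s t : S} {w : Γ.coxeterMatrix.Group} (h1 : ¬ LD w t)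
    (h2 : LD (w * σ s) t) : σ t * w = w * σ s := by
  rw [← CoxeterSystem.isRightDescent_inv_iff] at h1 h2
  rw [mul_inv_rev, CoxeterMatrix.simple_inv] at h2
  have h3 := congrArg (·⁻¹) (Γ.simple_mul_eq_of_isRightDescent h1 h2)
  simpa [CoxeterMatrix.simple_inv] using h3.symm

theorem eq_of_simple_mul_eq {s t : S} {w : Γ.coxeterMatrix.Group} (h : σ s * w = w * σ t) :
    s = t := by
  by_contra hne
  have h1 := congrArg (Γ.letterParity s) h
  rw [map_mul, map_mul, mul_comm, letterParity_self, Γ.letterParity_of_ne (Ne.symm hne)] at h1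
  exact absurd (mul_left_cancel h1) (by decide)

/-- A last letter r of w is also a descent of w t = t w, as is t. Hence r and t commute, and r can
be removed. -/
theorem mem_parabolic_neighborSet {t : S} {w : Γ.coxeterMatrix.Group} (h : σ t * w = w * σ t)
    (hd : ¬ RD w t) : w ∈ Γ.parabolic (Γ.neighborSet t) := by
  induction hn : ℓ w generalizing w with
  | zero => rw [Γ.cs.length_eq_zero_iff.1 hn]; exact one_mem _
  | succ n ih =>
    have hw1 : w ≠ 1 := by
      rintro rfl
      rw [Γ.cs.length_one] at hn
      exact absurd hn (by lia)
    obtain ⟨r, hr⟩ := Γ.cs.exists_rightDescent_of_ne_one hw1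
    have hrt : r ≠ t := by rintro rfl; exact hd hr
    have hr' := Γ.cs.isRightDescent_iff.1 hr
    have hd' := Γ.cs.not_isRightDescent_iff.1 hd
    simp only [CoxeterMatrix.toCoxeterSystem_simple] at hr' hd'
    have hadj : Γ.Adj r t := by
      refine Γ.adj_of_isRightDescent hrt (w := w * σ t) ?_ ?_
      · change ℓ (w * σ t * σ r) < ℓ (w * σ t)
        rw [← h, mul_assoc, h, hd']
        have := Γ.cs.length_mul_le (σ t) (w * σ r)
        have h1 := Γ.cs.length_simple t
        simp only [CoxeterMatrix.toCoxeterSystem_simple] at h1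
        lia
      · change ℓ (w * σ t * σ t) < ℓ (w * σ t)
        rw [CoxeterMatrix.simple_mul_cancel_right]
        lia
    have hc := Γ.simple_comm hadj
    have h1 : w * σ r ∈ Γ.parabolic (Γ.neighborSet t) := by
      refine ih ?_ ?_ (by lia)
      · rw [← mul_assoc, h, mul_assoc, mul_assoc, hc]
      · rw [Γ.isRightDescent_mul_simple_iff hadj.symm]; exact hd
    have h2 := mul_mem h1 (Γ.simple_mem_parabolic (J := Γ.neighborSet t) (s := r) hadj.symm)
    rwa [CoxeterMatrix.simple_mul_cancel_right] at h2

theorem simple_comm_of_mem_parabolic {t : S} {w : Γ.coxeterMatrix.Group}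
    (h : w ∈ Γ.parabolic (Γ.neighborSet t)) : σ t * w = w * σ t := by
  have h1 : Γ.parabolic (Γ.neighborSet t) ≤ Subgroup.centralizer {σ t} := by
    rw [Subgroup.closure_le]
    rintro _ ⟨r, hr, rfl⟩
    rw [SetLike.mem_coe, Subgroup.mem_centralizer_singleton_iff]
    exact (Γ.simple_comm hr).symm
  exact (Subgroup.mem_centralizer_singleton_iff.1 (h1 h)).symm

/-- A letter that becomes a left descent by multiplication on the right. -/
theorem eq_and_mem_of_isLeftDescent_mul {s t : S} {w : Γ.coxeterMatrix.Group} (h1 : ¬ LD w t)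
    (h2 : LD (w * σ s) t) : s = t ∧ w ∈ Γ.parabolic (Γ.neighborSet t) := by
  have h := Γ.simple_mul_eq_of_isLeftDescent h1 h2
  obtain rfl := Γ.eq_of_simple_mul_eq h
  refine ⟨rfl, Γ.mem_parabolic_neighborSet h ?_⟩
  change ¬ ℓ (w * σ t) < ℓ w
  rw [← h]
  exact h1

theorem isLeftDescent_simple_iff {s t : S} : LD (σ s) t ↔ s = t := by
  constructor
  · intro h
    by_contra hne
    exact Γ.not_isLeftDescent_of_mem_parabolic (J := {s}) (Γ.simple_mem_parabolic rfl)
      (fun h' => hne h'.symm) h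
  · rintro rfl
    change ℓ (σ s * σ s) < ℓ (σ s)
    have h1 := Γ.cs.length_simple s
    simp only [CoxeterMatrix.toCoxeterSystem_simple] at h1
    rw [CoxeterMatrix.simple_mul_self, h1, Γ.cs.length_one]
    exact one_pos

theorem isRightDescent_simple_iff {s t : S} : RD (σ s) t ↔ s = t := by
  rw [← CoxeterSystem.isLeftDescent_inv_iff, CoxeterMatrix.simple_inv, isLeftDescent_simple_iff]

theorem isLeftDescent_simple_mul {s : S} {w : Γ.coxeterMatrix.Group} (h : ¬ LD w s) :
    LD (σ s * w) s := by
  by_contra h'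
  exact h (Γ.cs.isLeftDescent_iff_not_isLeftDescent_mul.2 h')

/-- For non-commuting `r` and `s`, the letter `s` is not a left descent of `r s r`. -/
theorem not_isLeftDescent_conj {r s : S} (hne : r ≠ s) (h : ¬ Γ.Adj r s) :
    LD (σ r * σ s * σ r) r ∧ ¬ LD (σ r * σ s * σ r) s := by
  have h1 : ¬ LD (σ s * σ r) r := fun h1 =>
    h (Γ.adj_of_isLeftDescent hne h1 (Γ.isLeftDescent_simple_mul
      (mt Γ.isLeftDescent_simple_iff.1 hne)))
  rw [mul_assoc]
  have h2 := Γ.isLeftDescent_simple_mul h1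
  exact ⟨h2, fun h3 => h (Γ.adj_of_isLeftDescent hne h2 h3)⟩

end SimpleGraph

/-! ### Galleries and panels -/

namespace Building

section Basic

variable {S : Type v} {M : CoxeterMatrix S} {C : Type u} (B : Building M C)

local notation "ℓ" => CoxeterSystem.length (CoxeterMatrix.toCoxeterSystem M)
local notation "LD" => CoxeterSystem.IsLeftDescent (CoxeterMatrix.toCoxeterSystem M)
local notation "RD" => CoxeterSystem.IsRightDescent (CoxeterMatrix.toCoxeterSystem M)

@[simp] theorem δ_self (x : C) : B.δ x x = 1 := (B.δ_eq_one_iff x x).2 rfl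

/-- There is a gallery of the given type from `x` to `y`. -/
def HasGallery : List S → C → C → Prop
  | [], x, y => x = y
  | s :: l, x, y => ∃ z, B.δ x z = M.simple s ∧ HasGallery l z y

/-- The existence axiom allows walking along any word for the Weyl distance, reduced or not; only
the converse needs a reduced word. -/
theorem hasGallery_of_δ_eq (l : List S) {x y : C} (h : B.δ x y = M.toCoxeterSystem.wordProd l) :
    B.HasGallery l x y := by
  induction l generalizing x with
  | nil => exact (B.δ_eq_one_iff x y).1 h
  | cons s l ih =>
    obtain ⟨z, hz1, hz2⟩ := B.exists_adj s x y
    have hzx : B.δ x z = M.simple s := by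
      rcases B.δ_of_adj s x z z hz1 with h1 | h1
      · rw [δ_self] at h1
        rw [← M.simple_inv]
        exact (inv_eq_of_mul_eq_one_right h1.symm).symm
      · rw [δ_self] at h1
        rw [(B.δ_eq_one_iff _ _).1 h1.symm, δ_self] at hz1
        exact absurd hz1.symm (M.simple_ne_one s)
    refine ⟨z, hzx, ih ?_⟩
    rw [hz2, h, CoxeterSystem.wordProd_cons]
    exact M.simple_mul_cancel_left s _

theorem δ_eq_of_hasGallery {l : List S} (hl : M.toCoxeterSystem.IsReduced l) {x y : C}
    (h : B.HasGallery l x y) : B.δ x y = M.toCoxeterSystem.wordProd l := by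
  induction l generalizing x with
  | nil => exact (B.δ_eq_one_iff x y).2 h
  | cons s l ih =>
    obtain ⟨z, hz, hg⟩ := h
    have hl' : M.toCoxeterSystem.IsReduced l := by simpa using hl.drop 1
    have h1 := ih hl' hg
    rw [CoxeterSystem.wordProd_cons, CoxeterMatrix.toCoxeterSystem_simple, ← h1]
    refine B.δ_of_adj_of_length_lt s z y x hz ?_
    rw [h1, hl'.eq, ← CoxeterMatrix.toCoxeterSystem_simple, ← CoxeterSystem.wordProd_cons, hl.eq]
    simp

theorem δ_symm_of_eq_simple {s : S} {x y : C} (h : B.δ x y = M.simple s) :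
    B.δ y x = M.simple s := by
  rcases B.δ_of_adj s y x x h with h1 | h1
  · rw [δ_self] at h1
    rw [← M.simple_inv]
    exact (inv_eq_of_mul_eq_one_right h1.symm).symm
  · rw [δ_self] at h1
    rw [(B.δ_eq_one_iff _ _).1 h1.symm, δ_self] at h
    exact absurd h.symm (M.simple_ne_one s)

theorem HasGallery.concat {l : List S} {x y z : C} {s : S} (h : B.HasGallery l x y)
    (hz : B.δ y z = M.simple s) : B.HasGallery (l ++ [s]) x z := by
  induction l generalizing x with
  | nil => obtain rfl : x = y := h; exact ⟨z, hz, rfl⟩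
  | cons t l ih => obtain ⟨c, hc, hg⟩ := h; exact ⟨c, hc, ih hg⟩

theorem HasGallery.reverse {l : List S} {x y : C} (h : B.HasGallery l x y) :
    B.HasGallery l.reverse y x := by
  induction l generalizing x with
  | nil => exact Eq.symm h
  | cons t l ih =>
    obtain ⟨c, hc, hg⟩ := h
    rw [List.reverse_cons]
    exact HasGallery.concat B (ih hg) (B.δ_symm_of_eq_simple hc)

theorem δ_symm (x y : C) : B.δ y x = (B.δ x y)⁻¹ := by
  obtain ⟨l, hl, h⟩ := M.toCoxeterSystem.exists_isReduced (B.δ x y)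
  rw [B.δ_eq_of_hasGallery hl.reverse (HasGallery.reverse B (B.hasGallery_of_δ_eq l h)), h,
    CoxeterSystem.wordProd_reverse]

theorem δ_adj_right {s : S} {y z : C} (h : B.δ y z = M.simple s) (x : C) :
    B.δ x z = B.δ x y * M.simple s ∨ B.δ x z = B.δ x y := by
  rcases B.δ_of_adj s y x z (B.δ_symm_of_eq_simple h) with h1 | h1
  · left
    rw [B.δ_symm z x, h1, mul_inv_rev, M.simple_inv, ← B.δ_symm]
  · right
    rw [B.δ_symm z x, h1, ← B.δ_symm]

theorem δ_adj_right_of_not_isRightDescent {s : S} {y z : C} (h : B.δ y z = M.simple s) {x : C}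
    (hd : ¬ RD (B.δ x y) s) : B.δ x z = B.δ x y * M.simple s := by
  rw [B.δ_symm z x, B.δ_of_adj_of_length_lt s y x z (B.δ_symm_of_eq_simple h), mul_inv_rev,
    M.simple_inv, ← B.δ_symm]
  rw [← CoxeterSystem.isLeftDescent_inv_iff, ← B.δ_symm, CoxeterSystem.not_isLeftDescent_iff] at hd
  rw [M.toCoxeterSystem_simple] at hd
  lia

theorem δ_adj_left_of_not_isLeftDescent {s : S} {x z : C} (h : B.δ z x = M.simple s) {y : C}
    (hd : ¬ LD (B.δ x y) s) : B.δ z y = M.simple s * B.δ x y := by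
  refine B.δ_of_adj_of_length_lt s x y z h ?_
  rw [CoxeterSystem.not_isLeftDescent_iff, M.toCoxeterSystem_simple] at hd
  lia

theorem exists_adj_right (s : S) (x y : C) :
    ∃ z, B.δ y z = M.simple s ∧ B.δ x z = B.δ x y * M.simple s := by
  obtain ⟨z, h1, h2⟩ := B.exists_adj s y x
  refine ⟨z, B.δ_symm_of_eq_simple h1, ?_⟩
  rw [B.δ_symm z x, h2, mul_inv_rev, M.simple_inv, ← B.δ_symm]

theorem adj_induction {P : C → Prop} (c : C) (h0 : P c)
    (hstep : ∀ (s : S) (x y : C), B.δ x y = M.simple s → P x → P y) (x : C) : P x := by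
  obtain ⟨l, hl⟩ := M.toCoxeterSystem.wordProd_surjective (B.δ c x)
  have hg := B.hasGallery_of_δ_eq l hl.symm
  clear hl
  induction l generalizing c with
  | nil => obtain rfl : c = x := hg; exact h0
  | cons s l ih =>
    obtain ⟨z, hz, hg⟩ := hg
    exact ih z (hstep s c z hz h0) hg

theorem mem_panel_iff {s : S} {c d : C} : d ∈ B.panel s c ↔ d = c ∨ B.δ c d = M.simple s := by
  change (_ ∨ _) ↔ _
  rw [B.δ_eq_one_iff, eq_comm]

theorem mem_panel_of_δ_eq {s : S} {c d : C} (h : B.δ c d = M.simple s) : d ∈ B.panel s c :=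
  Or.inr h

theorem mem_panel_symm {s : S} {c d : C} (h : d ∈ B.panel s c) : c ∈ B.panel s d := by
  rcases B.mem_panel_iff.1 h with rfl | h
  · exact h
  · exact B.mem_panel_of_δ_eq (B.δ_symm_of_eq_simple h)

theorem mem_panel_trans {s : S} {c d e : C} (h : d ∈ B.panel s c) (h' : e ∈ B.panel s d) :
    e ∈ B.panel s c := by
  rcases B.mem_panel_iff.1 h with rfl | h
  · exact h'
  rcases B.mem_panel_iff.1 h' with rfl | h'
  · exact B.mem_panel_of_δ_eq h
  rcases B.δ_adj_right h' c with h1 | h1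
  · left; rw [h1, h, M.simple_mul_self]
  · right; rw [h1, h]

theorem δ_eq_simple_of_mem_panel {s : S} {c d : C} (h : d ∈ B.panel s c) (hne : d ≠ c) :
    B.δ c d = M.simple s := (B.mem_panel_iff.1 h).resolve_left hne

theorem δ_ne_simple_self (s : S) (c : C) : B.δ c c ≠ M.simple s := by
  rw [δ_self]; exact (M.simple_ne_one s).symm

theorem ne_of_δ_eq_simple {s : S} {c d : C} (h : B.δ c d = M.simple s) : d ≠ c := by
  rintro rfl; exact B.δ_ne_simple_self s _ h

/-- The projection of `x` to the `s`-panel of `c`. -/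
theorem exists_proj (s : S) (x c : C) : ∃ p ∈ B.panel s c, ¬ RD (B.δ x p) s ∧
    ∀ y ∈ B.panel s c, y ≠ p → B.δ x y = B.δ x p * M.simple s := by
  by_cases h : RD (B.δ x c) s
  · obtain ⟨p, hp, hxp⟩ := B.exists_adj_right s x c
    have hpc : p ∈ B.panel s c := B.mem_panel_of_δ_eq hp
    have hd : ¬ RD (B.δ x p) s := by
      rw [hxp]; exact M.toCoxeterSystem.isRightDescent_iff_not_isRightDescent_mul.1 h
    exact ⟨p, hpc, hd, fun y hy hne => B.δ_adj_right_of_not_isRightDescent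
      (B.δ_eq_simple_of_mem_panel (B.mem_panel_trans (B.mem_panel_symm hpc) hy) hne) hd⟩
  · exact ⟨c, B.self_mem_panel s c, h, fun y hy hne =>
      B.δ_adj_right_of_not_isRightDescent (B.δ_eq_simple_of_mem_panel hy hne) h⟩

theorem isRightDescent_mul {s : S} {w : M.Group} (h : ¬ RD w s) : RD (w * M.simple s) s := by
  by_contra h'
  exact h (M.toCoxeterSystem.isRightDescent_iff_not_isRightDescent_mul.2 h')

theorem isLeftDescent_mul {s : S} {w : M.Group} (h : ¬ LD w s) : LD (M.simple s * w) s := by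
  by_contra h'
  exact h (M.toCoxeterSystem.isLeftDescent_iff_not_isLeftDescent_mul.2 h')

/-- The map carries a reduced gallery to a gallery of the same type, and a reduced type determines
the distance. -/
theorem δ_eq_of_adj_preserving {C' : Type*} (B' : Building M C') (f : C → C')
    (hf : ∀ (s : S) (x y : C), B.δ x y = M.simple s → B'.δ (f x) (f y) = M.simple s) (x y : C) :
    B'.δ (f x) (f y) = B.δ x y := by
  obtain ⟨l, hl, h⟩ := M.toCoxeterSystem.exists_isReduced (B.δ x y)
  have hg := B.hasGallery_of_δ_eq l h
  rw [h]
  refine B'.δ_eq_of_hasGallery hl ?_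
  clear h hl
  induction l generalizing x with
  | nil => exact congrArg f hg
  | cons s l ih =>
    obtain ⟨z, hz, hg⟩ := hg
    exact ⟨f z, hf s x z hz, ih z hg⟩

/-! ### Wings -/

/-- The `s`-wing of `c`: the chambers whose projection to the `s`-panel of `c` is `c`. -/
def wing (s : S) (c : C) : Set C := {x | ¬ LD (B.δ c x) s}

theorem mem_wing_iff {s : S} {c x : C} : x ∈ B.wing s c ↔ ¬ LD (B.δ c x) s := Iff.rfl

theorem not_mem_wing_iff {s : S} {c x : C} : x ∉ B.wing s c ↔ LD (B.δ c x) s := not_not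

theorem self_mem_wing (s : S) (c : C) : c ∈ B.wing s c := by
  rw [mem_wing_iff, δ_self]; exact M.toCoxeterSystem.not_isLeftDescent_one s

theorem δ_smul (g : B.aut) (x y : C) : B.δ (g • x) (g • y) = B.δ x y := g.2 x y

theorem smul_mem_wing_iff (g : B.aut) (s : S) (c x : C) :
    g • x ∈ B.wing s (g • c) ↔ x ∈ B.wing s c := by
  rw [mem_wing_iff, mem_wing_iff, δ_smul]

/-- A half-space is gallery-connected: removing a last letter from s·δ(c, z) brings z closer to c
without entering the wing, until z lies on the s-panel of c. -/
theorem compl_wing_induction {s : S} {c : C} {P : C → Prop}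
    (h0 : ∀ e, B.δ c e = M.simple s → P e)
    (hstep : ∀ (t : S) (x y : C), x ∉ B.wing s c → y ∉ B.wing s c → B.δ x y = M.simple t →
      P x → P y) (z : C) (hz : z ∉ B.wing s c) : P z := by
  induction hn : ℓ (B.δ c z) generalizing z with
  | zero =>
    rw [not_mem_wing_iff, M.toCoxeterSystem.length_eq_zero_iff.1 hn] at hz
    exact absurd hz (M.toCoxeterSystem.not_isLeftDescent_one s)
  | succ n ih =>
    have hz' := M.toCoxeterSystem.isLeftDescent_iff.1 (B.not_mem_wing_iff.1 hz)
    rw [M.toCoxeterSystem_simple] at hz'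
    by_cases h1 : M.simple s * B.δ c z = 1
    · refine h0 z ?_
      rw [← M.simple_inv s, ← inv_eq_of_mul_eq_one_right h1]
    obtain ⟨t, ht⟩ := M.toCoxeterSystem.exists_rightDescent_of_ne_one h1
    have ht' := M.toCoxeterSystem.isRightDescent_iff.1 ht
    rw [M.toCoxeterSystem_simple] at ht'
    obtain ⟨y, hy, hcy⟩ := B.exists_adj_right t c z
    have h2 : ℓ (M.simple s * B.δ c y) + 2 = ℓ (B.δ c z) := by
      rw [hcy, ← mul_assoc]; lia
    have h3 : ℓ (B.δ c y) ≤ ℓ (M.simple s * B.δ c y) + 1 := by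
      have := M.toCoxeterSystem.length_mul_le (M.simple s) (M.simple s * B.δ c y)
      have h4 := M.toCoxeterSystem.length_simple s
      rw [M.toCoxeterSystem_simple] at h4
      rw [M.simple_mul_cancel_left] at this
      lia
    have h5 := M.toCoxeterSystem.length_mul_simple (B.δ c z) t
    rw [M.toCoxeterSystem_simple, ← hcy] at h5
    have h6 : y ∉ B.wing s c := by
      rw [not_mem_wing_iff]
      change ℓ (M.simple s * B.δ c y) < ℓ (B.δ c y)
      lia
    exact hstep t y z h6 hz (B.δ_symm_of_eq_simple hy) (ih y h6 (by lia))

theorem wing_subset_compl_wing {s : S} {c d : C} (h : B.δ c d = M.simple s) :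
    B.wing s d ⊆ (B.wing s c)ᶜ := by
  intro x hx
  rw [Set.mem_compl_iff, not_mem_wing_iff, B.δ_adj_left_of_not_isLeftDescent h hx]
  exact isLeftDescent_mul hx

end Basic

/-! ### Wings and tree-walls in right-angled buildings. -/

section RightAngled

variable {S : Type v} {Γ : SimpleGraph S} {C : Type u} (B : Building Γ.coxeterMatrix C)

local notation "σ" => CoxeterMatrix.simple (SimpleGraph.coxeterMatrix Γ)
local notation "ℓ" => CoxeterSystem.length (SimpleGraph.cs Γ)
local notation "LD" => CoxeterSystem.IsLeftDescent (SimpleGraph.cs Γ)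
local notation "RD" => CoxeterSystem.IsRightDescent (SimpleGraph.cs Γ)

/-- A panel that leaves a wing does so at a chamber of the tree-wall. -/
theorem crossing {s t : S} {c x y : C} (hx : x ∈ B.wing s c) (hy : y ∉ B.wing s c)
    (hxy : y ∈ B.panel t x) : t = s ∧ B.δ c x ∈ Γ.parabolic (Γ.neighborSet s) := by
  have hne : y ≠ x := by rintro rfl; exact hy hx
  rw [not_mem_wing_iff] at hy
  rcases B.δ_adj_right (B.δ_eq_simple_of_mem_panel hxy hne) c with h | h
  · rw [h] at hy
    exact Γ.eq_and_mem_of_isLeftDescent_mul hx hy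
  · rw [h] at hy
    exact absurd hy hx

theorem not_mem_wing_of_mem_panel {s : S} {c x z : C}
    (h : B.δ c x ∈ Γ.parabolic (Γ.neighborSet s)) (hz : z ∈ B.panel s x) (hne : z ≠ x) :
    z ∉ B.wing s c := by
  have h1 : s ∉ Γ.neighborSet s := Γ.irrefl
  rw [not_mem_wing_iff, B.δ_adj_right_of_not_isRightDescent (B.δ_eq_simple_of_mem_panel hz hne)
    (Γ.not_isRightDescent_of_mem_parabolic h h1), ← Γ.simple_comm_of_mem_parabolic h]
  exact isLeftDescent_mul (Γ.not_isLeftDescent_of_mem_parabolic h h1)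

theorem mem_wing_of_mem_parabolic {s : S} {c x : C}
    (h : B.δ c x ∈ Γ.parabolic (Γ.neighborSet s)) : x ∈ B.wing s c :=
  Γ.not_isLeftDescent_of_mem_parabolic h Γ.irrefl

theorem mem_treeWall_iff {s : S} {c x : C} :
    x ∈ B.treeWall s c ↔ B.δ c x ∈ Γ.parabolic (insert s (Γ.neighborSet s)) := Iff.rfl

theorem residue_induction {J : Set S} {c : C} {P : C → Prop} (h0 : P c)
    (hstep : ∀ t ∈ J, ∀ x y : C, B.δ x y = σ t → P x → P y) (x : C)
    (hx : B.δ c x ∈ Γ.parabolic J) : P x := by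
  generalize hw : B.δ c x = w at hx
  induction hx using Subgroup.closure_induction_right generalizing x with
  | one => rw [← (B.δ_eq_one_iff c x).1 hw]; exact h0
  | mul_right w hw' y hy ih =>
    obtain ⟨t, ht, rfl⟩ := hy
    obtain ⟨z, hz, hcz⟩ := B.exists_adj_right t c x
    rw [hw, CoxeterMatrix.simple_mul_cancel_right] at hcz
    exact hstep t ht z x (B.δ_symm_of_eq_simple hz) (ih z hcz)
  | mul_inv_cancel w hw' y hy ih =>
    obtain ⟨t, ht, rfl⟩ := hy
    obtain ⟨z, hz, hcz⟩ := B.exists_adj_right t c x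
    rw [hw, CoxeterMatrix.simple_inv, CoxeterMatrix.simple_mul_cancel_right] at hcz
    exact hstep t ht z x (B.δ_symm_of_eq_simple hz) (ih z hcz)

/-- Two complements of wings facing away from each other are disjoint. -/
theorem disjoint_compl_wing {s : S} {c d : C} (h1 : d ∈ B.wing s c) (h2 : c ∈ B.wing s d)
    (h3 : B.δ c d ∉ Γ.parabolic (Γ.neighborSet s)) :
    Disjoint (B.wing s c)ᶜ (B.wing s d)ᶜ := by
  rw [Set.disjoint_left]
  intro z hzc hzd
  refine hzc ?_
  -- Travel through the half-space of d. Entering the half-space of c would happen at a chamber x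
  -- joined to c by letters commuting with s. Such letters never leave the wing of d, which contains
  -- c, so x would lie in that wing.
  refine B.compl_wing_induction (P := fun z => z ∈ B.wing s c) ?_ ?_ z hzd
  · intro e he
    by_contra hec
    exact h3 (B.crossing h1 hec (B.mem_panel_of_δ_eq he)).2
  · intro t x y hx hy hxy hxc
    by_contra hyc
    have h4 := (B.crossing hxc hyc (B.mem_panel_of_δ_eq hxy)).2
    refine hx ?_
    refine B.residue_induction (P := fun x => x ∈ B.wing s d) h2 ?_ x h4
    intro t ht x y hxy hxd
    by_contra hyd
    obtain ⟨rfl, -⟩ := B.crossing hxd hyd (B.mem_panel_of_δ_eq hxy)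
    exact Γ.irrefl ht

/-- If q is the first letter of δ(d, z), then p is not, so prefixing p is reduced. This nests
half-spaces along edges of the complement graph. -/
theorem compl_wing_subset_compl_wing {p q : S} (hne : p ≠ q) (h : ¬ Γ.Adj p q) {c d : C}
    (hcd : B.δ c d = σ p) : (B.wing q d)ᶜ ⊆ (B.wing p c)ᶜ := by
  intro z hz
  rw [Set.mem_compl_iff, not_mem_wing_iff] at *
  have h1 : ¬ LD (B.δ d z) p := fun h1 => h (Γ.adj_of_isLeftDescent hne h1 hz)
  rw [B.δ_adj_left_of_not_isLeftDescent hcd h1]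
  exact isLeftDescent_mul h1

theorem treeWall_subset_compl_wing {p q : S} (hne : p ≠ q) (h : ¬ Γ.Adj p q) {c d : C}
    (hcd : B.δ c d = σ p) : B.treeWall q d ⊆ (B.wing p c)ᶜ := by
  intro z hz
  have h1 : ¬ LD (B.δ d z) p := Γ.not_isLeftDescent_of_mem_parabolic (B.mem_treeWall_iff.1 hz) (by
    rintro (h2 | h2)
    · exact hne h2
    · exact h (show Γ.Adj q p from h2).symm)
  rw [Set.mem_compl_iff, not_mem_wing_iff, B.δ_adj_left_of_not_isLeftDescent hcd h1]
  exact isLeftDescent_mul h1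

theorem compl_wing_subset_wing {p q : S} (hne : p ≠ q) (h : ¬ Γ.Adj p q) (c : C) :
    (B.wing q c)ᶜ ⊆ B.wing p c := by
  intro z hz h1
  exact h (Γ.adj_of_isLeftDescent hne h1 (B.not_mem_wing_iff.1 hz))

end RightAngled

end Building

/-! ### Developing maps from a right-angled building -/

namespace Building

variable {S : Type v} {Γ : SimpleGraph S} {C : Type u} (B : Building Γ.coxeterMatrix C)

local notation "σ" => CoxeterMatrix.simple (SimpleGraph.coxeterMatrix Γ)
local notation "ℓ" => CoxeterSystem.length (SimpleGraph.cs Γ)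
local notation "LD" => CoxeterSystem.IsLeftDescent (SimpleGraph.cs Γ)
local notation "RD" => CoxeterSystem.IsRightDescent (SimpleGraph.cs Γ)

/-- The relation obtained by developing reduced coloured galleries starting from `c₀`. -/
inductive Develops {Ω : S → Type w} {D : Type*} (μ : ∀ s, C → Ω s) (m : ∀ s, Ω s → D → D)
    (c₀ : C) (d₀ : D) : C → D → Prop
  | base : Develops μ m c₀ d₀ c₀ d₀
  | step (s : S) (p x : C) (d : D) : Develops μ m c₀ d₀ p d → ¬ RD (B.δ c₀ p) s →
      B.δ p x = σ s → Develops μ m c₀ d₀ x (m s (μ s x) d)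

section

variable {Ω : S → Type w} {D : Type*} {μ : ∀ s, C → Ω s} {m : ∀ s, Ω s → D → D}
  {c₀ : C} {d₀ : D}

theorem exists_develops (μ : ∀ s, C → Ω s) (m : ∀ s, Ω s → D → D) (c₀ : C) (d₀ : D) (x : C) :
    ∃ d, B.Develops μ m c₀ d₀ x d := by
  induction hn : ℓ (B.δ c₀ x) generalizing x with
  | zero =>
    rw [Γ.cs.length_eq_zero_iff, B.δ_eq_one_iff] at hn
    subst hn
    exact ⟨d₀, .base⟩
  | succ n ih =>
    have h1 : B.δ c₀ x ≠ 1 := by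
      intro h
      rw [h, Γ.cs.length_one] at hn
      exact absurd hn (by lia)
    obtain ⟨s, hs⟩ := Γ.cs.exists_rightDescent_of_ne_one h1
    obtain ⟨p, hp, hcp⟩ := B.exists_adj_right s c₀ x
    have h2 := Γ.cs.isRightDescent_iff.1 hs
    rw [CoxeterMatrix.toCoxeterSystem_simple, ← hcp] at h2
    obtain ⟨d, hd⟩ := ih p (by lia)
    refine ⟨_, .step s p x d hd ?_ (B.δ_symm_of_eq_simple hp)⟩
    rw [hcp]
    exact Γ.cs.isRightDescent_iff_not_isRightDescent_mul.1 hs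

theorem proj_unique {s : S} {c₀ p p' x : C} (hp : ¬ RD (B.δ c₀ p) s) (hp' : ¬ RD (B.δ c₀ p') s)
    (h : B.δ p x = σ s) (h' : B.δ p' x = σ s) : p = p' := by
  by_contra hne
  have h1 : p ∈ B.panel s p' := B.mem_panel_trans (B.mem_panel_of_δ_eq h')
    (B.mem_panel_symm (B.mem_panel_of_δ_eq h))
  refine hp ?_
  rw [B.δ_adj_right_of_not_isRightDescent (B.δ_eq_simple_of_mem_panel h1 hne) hp']
  exact isRightDescent_mul hp'

/-- A diamond argument by induction on the distance from `c₀`: if two last steps s and t lead to x,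
they commute, and both predecessors are developed from a common chamber q, where the moves commute
as well. -/
theorem develops_unique (hμ : ∀ s t : S, t ≠ s → ∀ c d : C, d ∈ B.panel t c → μ s d = μ s c)
    (hcomm : ∀ s t, Γ.Adj s t → ∀ a b y, m s a (m t b y) = m t b (m s a y))
    {x : C} {d d' : D} (h : B.Develops μ m c₀ d₀ x d) (h' : B.Develops μ m c₀ d₀ x d') :
    d = d' := by
  induction hn : ℓ (B.δ c₀ x) using Nat.strong_induction_on generalizing x d d' with
  | _ n ih =>
  have hlen : ∀ (s : S) (p x : C), ¬ RD (B.δ c₀ p) s → B.δ p x = σ s →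
      ℓ (B.δ c₀ x) = ℓ (B.δ c₀ p) + 1 := by
    intro s p x hp hx
    rw [B.δ_adj_right_of_not_isRightDescent hx hp]
    exact Γ.cs.not_isRightDescent_iff.1 hp
  have hne1 : ∀ (s : S) (p : C), ¬ RD (B.δ c₀ p) s → B.δ p c₀ ≠ σ s := by
    intro s p hp hx
    have := hlen s p c₀ hp hx
    rw [δ_self, Γ.cs.length_one] at this
    lia
  cases h with
  | base =>
    cases h' with
    | base => rfl
    | step s p _ e hpe hp hx => exact absurd hx (hne1 s p hp)
  | step s p _ e hpe hp hx =>
    cases h' with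
    | base => exact absurd hx (hne1 s p hp)
    | step t p' _ e' hpe' hp' hx' =>
      have hl := hlen s p x hp hx
      have hl' := hlen t p' x hp' hx'
      by_cases hst : s = t
      · subst hst
        obtain rfl := B.proj_unique hp hp' hx hx'
        rw [ih _ (by lia) hpe hpe' rfl]
      · have hw := B.δ_adj_right_of_not_isRightDescent hx hp
        have hw' := B.δ_adj_right_of_not_isRightDescent hx' hp'
        have hRs : RD (B.δ c₀ x) s := by rw [hw]; exact isRightDescent_mul hp
        have hRt : RD (B.δ c₀ x) t := by rw [hw']; exact isRightDescent_mul hp'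
        have hadj := Γ.adj_of_isRightDescent hst hRs hRt
        have hp2 : RD (B.δ c₀ p) t := by
          rw [← Γ.isRightDescent_mul_simple_iff hadj.symm, ← hw]; exact hRt
        -- The bottom of the square: q, p, x and p' are its corners, with x the one farthest from
        -- `c₀`.
        obtain ⟨q, hq, hcq⟩ := B.exists_adj_right t c₀ p
        have hqt : ¬ RD (B.δ c₀ q) t := by
          rw [hcq]; exact Γ.cs.isRightDescent_iff_not_isRightDescent_mul.1 hp2
        have hqs : ¬ RD (B.δ c₀ q) s := by
          rw [hcq, Γ.isRightDescent_mul_simple_iff hadj]; exact hp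
        have hqp : B.δ q p = σ t := B.δ_symm_of_eq_simple hq
        have hqx : B.δ q x = σ t * σ s := by
          rw [B.δ_adj_right_of_not_isRightDescent hx, hqp]
          rw [hqp]
          exact mt Γ.isRightDescent_simple_iff.1 (Ne.symm hst)
        obtain ⟨r, hr, hcr⟩ := B.exists_adj_right t q x
        have hqr : B.δ q r = σ s := by
          rw [hcr, hqx, ← Γ.simple_comm hadj, CoxeterMatrix.simple_mul_cancel_right]
        have hr' : ¬ RD (B.δ c₀ r) t := by
          rw [B.δ_adj_right_of_not_isRightDescent hqr hqs, Γ.isRightDescent_mul_simple_iff hadj.symm]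
          exact hqt
        obtain rfl : r = p' := B.proj_unique hr' hp' (B.δ_symm_of_eq_simple hr) hx'
        have hlq := hlen t q p hqt hqp
        obtain ⟨f, hf⟩ := B.exists_develops μ m c₀ d₀ q
        have h1 := ih _ (by lia) hpe (.step t q p f hf hqt hqp) rfl
        have h2 := ih _ (by lia) hpe' (.step s q r f hf hqs hqr) rfl
        rw [h1, h2, ← hμ t s hst p x (B.mem_panel_of_δ_eq hx),
          ← hμ s t (Ne.symm hst) r x (B.mem_panel_of_δ_eq hx'), hcomm s t hadj]

end

/-- A chamber system with commuting coloured moves receives a developing map from a right-angled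
building. -/
theorem exists_developing_map {Ω : S → Type w} {D : Type*} (μ : ∀ s, C → Ω s)
    (hμ : ∀ s t : S, t ≠ s → ∀ c d : C, d ∈ B.panel t c → μ s d = μ s c)
    (m : ∀ s, Ω s → D → D) (hidem : ∀ s a b y, m s a (m s b y) = m s a y)
    (hcomm : ∀ s t, Γ.Adj s t → ∀ a b y, m s a (m t b y) = m t b (m s a y))
    (hfix : ∀ s t, s ≠ t → ∀ a b y, m t b y = y → m t b (m s a y) = m s a y)
    (c₀ : C) (d₀ : D) (h₀ : ∀ s, m s (μ s c₀) d₀ = d₀) :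
    ∃ ρ : C → D, ρ c₀ = d₀ ∧ (∀ s x, m s (μ s x) (ρ x) = ρ x) ∧
      ∀ s x, ∀ y ∈ B.panel s x, ρ y = m s (μ s y) (ρ x) := by
  choose ρ hρ using B.exists_develops μ m c₀ d₀
  have huniq : ∀ {x d}, B.Develops μ m c₀ d₀ x d → ρ x = d := fun h =>
    B.develops_unique hμ hcomm (hρ _) h
  have hfixed : ∀ x d, B.Develops μ m c₀ d₀ x d → ∀ s, m s (μ s x) d = d := by
    intro x d h
    induction h with
    | base => exact h₀
    | step s p x d hd hp hx ih =>
      intro t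
      by_cases hst : s = t
      · subst hst; rw [hidem]
      · rw [hμ t s hst p x (B.mem_panel_of_δ_eq hx)]
        exact hfix s t hst _ _ _ (ih t)
  refine ⟨ρ, huniq .base, fun s x => hfixed x _ (hρ x) s, fun s x y hy => ?_⟩
  obtain ⟨p, hpx, hp, -⟩ := B.exists_proj s c₀ x
  have key : ∀ z ∈ B.panel s x, ρ z = m s (μ s z) (ρ p) := by
    intro z hz
    by_cases hzp : z = p
    · subst hzp; rw [hfixed z _ (hρ z)]
    · exact huniq (.step s p z _ (hρ p) hp (B.δ_eq_simple_of_mem_panel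
        (B.mem_panel_trans (B.mem_panel_symm hpx) hz) hzp))
  rw [key y hy, key x (B.self_mem_panel s x), hidem]

end Building

/-! ### Recolouring moves, and automorphisms from colourings. -/

namespace Building.LegalColouring

variable {S : Type v} {Γ : SimpleGraph S} {C : Type u} {B : Building Γ.coxeterMatrix C}
  {Ω : S → Type w} (col : B.LegalColouring Ω)

local notation "σ" => CoxeterMatrix.simple (SimpleGraph.coxeterMatrix Γ)

/-- The chamber with a given colour in a panel. -/
noncomputable def move (s : S) (a : Ω s) (c : C) : C :=
  ((col.bijOn_panel s c).surjOn (Set.mem_univ a)).choose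

theorem move_mem (s : S) (a : Ω s) (c : C) : col.move s a c ∈ B.panel s c :=
  ((col.bijOn_panel s c).surjOn (Set.mem_univ a)).choose_spec.1

@[simp] theorem colour_move (s : S) (a : Ω s) (c : C) : col.colour s (col.move s a c) = a :=
  ((col.bijOn_panel s c).surjOn (Set.mem_univ a)).choose_spec.2

theorem colour_move_of_ne {s t : S} (h : s ≠ t) (a : Ω s) (c : C) :
    col.colour t (col.move s a c) = col.colour t c :=
  col.constant_on_panel t s h _ _ (col.move_mem s a c)

theorem eq_move {s : S} {a : Ω s} {c d : C} (h : d ∈ B.panel s c) (ha : col.colour s d = a) :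
    d = col.move s a c :=
  (col.bijOn_panel s c).injOn h (col.move_mem s a c) (by rw [ha, colour_move])

theorem move_colour (s : S) (c : C) : col.move s (col.colour s c) c = c :=
  (col.eq_move (B.self_mem_panel s c) rfl).symm

theorem move_eq_self_iff {s : S} {a : Ω s} {c : C} : col.move s a c = c ↔ col.colour s c = a := by
  constructor
  · intro h; rw [← h, colour_move]
  · rintro rfl; exact col.move_colour s c

theorem move_move (s : S) (a b : Ω s) (c : C) : col.move s a (col.move s b c) = col.move s a c :=
  col.eq_move (B.mem_panel_trans (col.move_mem s b c) (col.move_mem s a _)) (by simp)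

theorem δ_move {s : S} {a : Ω s} {c : C} (h : col.colour s c ≠ a) :
    B.δ c (col.move s a c) = σ s :=
  B.δ_eq_simple_of_mem_panel (col.move_mem s a c) (mt col.move_eq_self_iff.1 h)

theorem move_comm {s t : S} (h : Γ.Adj s t) (a : Ω s) (b : Ω t) (c : C) :
    col.move s a (col.move t b c) = col.move t b (col.move s a c) := by
  by_cases ha : col.colour s c = a
  · rw [col.move_eq_self_iff.2 ha, col.move_eq_self_iff, col.colour_move_of_ne h.symm.ne, ha]
  by_cases hb : col.colour t c = b
  · rw [col.move_eq_self_iff.2 hb, eq_comm, col.move_eq_self_iff, col.colour_move_of_ne h.ne, hb]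
  have h1 := col.δ_move hb
  have h2 : B.δ (col.move t b c) (col.move s a (col.move t b c)) = σ s :=
    col.δ_move (by rwa [col.colour_move_of_ne h.symm.ne])
  have h3 : B.δ c (col.move s a (col.move t b c)) = σ t * σ s := by
    rw [B.δ_adj_right_of_not_isRightDescent h2, h1]
    rw [h1]
    exact mt Γ.isRightDescent_simple_iff.1 h.symm.ne
  obtain ⟨q, hq, hcq⟩ := B.exists_adj_right t c (col.move s a (col.move t b c))
  rw [h3, ← Γ.simple_comm h, CoxeterMatrix.simple_mul_cancel_right] at hcq
  have hq' := B.mem_panel_of_δ_eq (B.δ_symm_of_eq_simple hq)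
  have h4 : q = col.move s a c := by
    refine col.eq_move (B.mem_panel_of_δ_eq hcq) ?_
    rw [← col.constant_on_panel s t h.symm.ne _ _ hq', colour_move]
  rw [← h4]
  refine col.eq_move hq' ?_
  rw [col.colour_move_of_ne h.ne, colour_move]

theorem ext_of_colour {f g : C → C} (hf : ∀ s x y, y ∈ B.panel s x → f y ∈ B.panel s (f x))
    (hg : ∀ s x y, y ∈ B.panel s x → g y ∈ B.panel s (g x)) {c : C} (hc : f c = g c)
    (hcol : ∀ s x, col.colour s (f x) = col.colour s (g x)) (x : C) : f x = g x := by
  refine B.adj_induction (P := fun x => f x = g x) c hc ?_ x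
  intro s x y hxy h
  have hy := B.mem_panel_of_δ_eq hxy
  rw [col.eq_move (hf s x y hy) rfl, col.eq_move (hg s x y hy) rfl, h, hcol]

/-- An automorphism is determined by the image of one chamber and the induced colouring. -/
theorem aut_ext {g h : B.aut} {c : C} (hc : g • c = h • c)
    (hcol : ∀ s (x : C), col.colour s (g • x) = col.colour s (h • x)) : g = h := by
  apply Subtype.ext
  apply Equiv.ext
  exact col.ext_of_colour (f := fun x => g • x) (g := fun x => h • x)
    (fun s x y hy => (B.smul_mem_panel_iff g s x y).2 hy)
    (fun s x y hy => (B.smul_mem_panel_iff h s x y).2 hy) hc hcol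

/-- The developing map with the building itself as target: each step follows the colours of `μ` but
moves inside the panels coloured by `col`. -/
theorem exists_map (μ : B.LegalColouring Ω) {c d : C}
    (h : ∀ s, col.colour s d = μ.colour s c) :
    ∃ ρ : C → C, ρ c = d ∧ (∀ s x, col.colour s (ρ x) = μ.colour s x) ∧
      ∀ s x y, y ∈ B.panel s x → ρ y ∈ B.panel s (ρ x) := by
  obtain ⟨ρ, h1, h2, h3⟩ := B.exists_developing_map μ.colour μ.constant_on_panel col.move
    col.move_move (fun s t hst => col.move_comm hst)
    (fun s t hst a b y hy => by
      rw [move_eq_self_iff] at hy ⊢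
      rwa [col.colour_move_of_ne hst]) c d (fun s => col.move_eq_self_iff.2 (h s))
  refine ⟨ρ, h1, fun s x => col.move_eq_self_iff.1 (h2 s x), fun s x y hy => ?_⟩
  rw [h3 s x y hy]
  exact col.move_mem _ _ _

/-- Any two legal colourings are related by an automorphism. -/
theorem exists_aut (μ : B.LegalColouring Ω) {c d : C}
    (h : ∀ s, col.colour s d = μ.colour s c) :
    ∃ g : B.aut, g • c = d ∧ ∀ s (x : C), col.colour s (g • x) = μ.colour s x := by
  obtain ⟨ρ, h1, h2, h3⟩ := col.exists_map μ h
  obtain ⟨τ, k1, k2, k3⟩ := μ.exists_map col (fun s => (h s).symm)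
  have e1 : ∀ x, τ (ρ x) = x := μ.ext_of_colour (f := τ ∘ ρ) (g := id)
    (fun s x y hy => k3 _ _ _ (h3 _ _ _ hy)) (fun s x y hy => hy) (c := c)
    (by simp [h1, k1]) (fun s x => by simp [k2, h2])
  have e2 : ∀ x, ρ (τ x) = x := col.ext_of_colour (f := ρ ∘ τ) (g := id)
    (fun s x y hy => h3 _ _ _ (k3 _ _ _ hy)) (fun s x y hy => hy) (c := d)
    (by simp [h1, k1]) (fun s x => by simp [k2, h2])
  refine ⟨⟨⟨ρ, τ, e1, e2⟩, ?_⟩, h1, h2⟩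
  refine B.δ_eq_of_adj_preserving B ρ fun s x y hxy => ?_
  refine B.δ_eq_simple_of_mem_panel (h3 s x y (B.mem_panel_of_δ_eq hxy)) ?_
  intro he
  have := congrArg τ he
  rw [e1, e1] at this
  exact B.ne_of_δ_eq_simple hxy this

end Building.LegalColouring

/-! ### Elements of the universal group -/

namespace Building.LegalColouring

variable {S : Type v} {Γ : SimpleGraph S} {C : Type u} {B : Building Γ.coxeterMatrix C}
  {Ω : S → Type w} (col : B.LegalColouring Ω) (F : ∀ s : S, Subgroup (Equiv.Perm (Ω s)))

local notation "σ" => CoxeterMatrix.simple (SimpleGraph.coxeterMatrix Γ)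

open Classical in
/-- The legal colouring obtained by replacing the colour of one type. -/
noncomputable def replace (s : S) (μ : C → Ω s)
    (h1 : ∀ c, Set.BijOn μ (B.panel s c) Set.univ)
    (h2 : ∀ t, t ≠ s → ∀ c d, d ∈ B.panel t c → μ d = μ c) : B.LegalColouring Ω where
  colour := Function.update col.colour s μ
  bijOn_panel := by
    intro t c
    by_cases h : t = s
    · subst h; rw [Function.update_self]; exact h1 c
    · rw [Function.update_of_ne h]; exact col.bijOn_panel t c
  constant_on_panel := by
    intro r t htr c d hd
    by_cases h : r = s
    · subst h; rw [Function.update_self]; exact h2 t htr c d hd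
    · rw [Function.update_of_ne h]; exact col.constant_on_panel r t htr c d hd

/-- There are automorphisms that prescribe the colour of one type and fix the other colours. -/
theorem exists_aut_replace {s : S} {μ : C → Ω s}
    (h1 : ∀ c, Set.BijOn μ (B.panel s c) Set.univ)
    (h2 : ∀ t, t ≠ s → ∀ c d, d ∈ B.panel t c → μ d = μ c) {c d : C}
    (hs : col.colour s d = μ c) (ht : ∀ t, t ≠ s → col.colour t d = col.colour t c) :
    ∃ g : B.aut, g • c = d ∧ (∀ x : C, col.colour s (g • x) = μ x) ∧
      ∀ t, t ≠ s → ∀ x : C, col.colour t (g • x) = col.colour t x := by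
  classical
  have e1 : (col.replace s μ h1 h2).colour s = μ := by simp [replace]
  have e2 : ∀ t, t ≠ s → (col.replace s μ h1 h2).colour t = col.colour t := fun t h => by
    simp [replace, h]
  obtain ⟨g, hg, hcol⟩ := col.exists_aut (col.replace s μ h1 h2) (c := c) (d := d) (by
    intro t
    by_cases h : t = s
    · subst h; rw [e1, hs]
    · rw [e2 t h, ht t h])
  refine ⟨g, hg, fun x => ?_, fun t h x => ?_⟩
  · rw [hcol, e1]
  · rw [hcol, e2 t h]

theorem bijOn_colour_smul (g : B.aut) (s : S) (c : C) :
    Set.BijOn (fun x => col.colour s (g • x)) (B.panel s c) Set.univ := by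
  refine (col.bijOn_panel s (g • c)).comp (t := B.panel s (g • c)) (f := fun x => g • x) ?_
  refine ⟨fun x hx => (B.smul_mem_panel_iff g s c x).2 hx,
    (MulAction.injective g).injOn, fun y hy => ⟨g⁻¹ • y, ?_, smul_inv_smul g y⟩⟩
  rw [← B.smul_mem_panel_iff g, smul_inv_smul]
  exact hy

variable {F}

/-- The part of an element of the universal group that concerns the colours of type `s`. -/
theorem exists_single_colour {g : B.aut} (hg : g ∈ col.universalGroup F) (s : S) {c : C}
    (hc : g • c = c) : ∃ h ∈ col.universalGroup F, h • c = c ∧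
      (∀ x : C, col.colour s (h • x) = col.colour s (g • x)) ∧
      ∀ t, t ≠ s → ∀ x : C, col.colour t (h • x) = col.colour t x := by
  obtain ⟨h, h1, h2, h3⟩ := col.exists_aut_replace (s := s) (μ := fun x => col.colour s (g • x))
    (col.bijOn_colour_smul g s)
    (fun t ht c d hd => col.constant_on_panel s t ht _ _ ((B.smul_mem_panel_iff g t c d).2 hd))
    (c := c) (d := c) (by rw [hc]) (fun _ _ => rfl)
  refine ⟨h, fun t x => ?_, h1, h2, h3⟩
  by_cases ht : t = s
  · subst ht
    rw [(col.localAction_eq_iff h t x (col.localAction g t x)).2]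
    · exact hg t x
    · intro d hd
      rw [col.localAction_colour g t x d hd, h2]
  · rw [(col.localAction_eq_iff h t x 1).2]
    · exact one_mem _
    · intro d hd
      rw [h3 t ht]; rfl

/-- Applying one permutation to all colours of type s gives another legal colouring; its
automorphism acts locally by f on every s-panel and trivially on all other panels. -/
theorem exists_of_perm {s : S} {f : Equiv.Perm (Ω s)} (hf : f ∈ F s) {c d : C}
    (hs : col.colour s d = f (col.colour s c))
    (ht : ∀ t, t ≠ s → col.colour t d = col.colour t c) :
    ∃ h ∈ col.universalGroup F, h • c = d ∧
      (∀ x : C, col.colour s (h • x) = f (col.colour s x)) ∧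
      ∀ t, t ≠ s → ∀ x : C, col.colour t (h • x) = col.colour t x := by
  obtain ⟨h, h1, h2, h3⟩ := col.exists_aut_replace (s := s) (μ := fun x => f (col.colour s x))
    (fun c => (f.bijective.bijOn_univ).comp (col.bijOn_panel s c))
    (fun t ht c d hd => congrArg f (col.constant_on_panel s t ht _ _ hd)) hs ht
  refine ⟨h, fun t x => ?_, h1, h2, h3⟩
  by_cases ht : t = s
  · subst ht
    rw [(col.localAction_eq_iff h t x f).2]
    · exact hf
    · intro d hd
      rw [h2]
  · rw [(col.localAction_eq_iff h t x 1).2]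
    · exact one_mem _
    · intro d hd
      rw [h3 t ht]; rfl

theorem smul_eq_of_colour_fixed {g : B.aut} {s : S} {x y : C} (hx : g • x = x)
    (hy : y ∈ B.panel s x) (hcol : col.colour s (g • y) = col.colour s y) : g • y = y := by
  have h := (B.smul_mem_panel_iff g s x y).2 hy
  rw [hx] at h
  exact (col.bijOn_panel s x).injOn h hy hcol

theorem fixes_residue {g : B.aut} {J : Set S} {c : C} (hc : g • c = c)
    (hcol : ∀ t ∈ J, ∀ x : C, col.colour t (g • x) = col.colour t x) {x : C}
    (hx : B.δ c x ∈ Γ.parabolic J) : g • x = x :=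
  B.residue_induction (P := fun x => g • x = x) hc (fun t ht _ y hxy h =>
    col.smul_eq_of_colour_fixed h (B.mem_panel_of_δ_eq hxy) (hcol t ht y)) x hx

/-- The type of the tree-wall does not contain r, so all colours used inside it are preserved and
the fixed chamber spreads along its galleries. -/
theorem fixes_treeWall {g : B.aut} {r q : S} (hne : r ≠ q) (hq : ¬ Γ.Adj r q) {c : C}
    (hc : g • c = c) (hcol : ∀ t, t ≠ r → ∀ x : C, col.colour t (g • x) = col.colour t x) {x : C}
    (hx : x ∈ B.treeWall q c) : g • x = x := by
  refine col.fixes_residue hc (fun t ht => hcol t ?_) (B.mem_treeWall_iff.1 hx)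
  rintro rfl
  rcases ht with h | h
  · exact hne h
  · exact hq (show Γ.Adj q t from h).symm

/-- Chamber stabilizers are generated by elements that only change the colours of one type. -/
theorem mem_of_single_colour [Finite S] (N : Subgroup B.aut) {c : C}
    (hN : ∀ g ∈ col.universalGroup F, ∀ r, g • c = c →
      (∀ t, t ≠ r → ∀ x : C, col.colour t (g • x) = col.colour t x) → g ∈ N)
    {g : B.aut} (hg : g ∈ col.universalGroup F) (hc : g • c = c) : g ∈ N := by
  classical
  have _ := Fintype.ofFinite S
  have key : ∀ T : Finset S, ∀ g ∈ col.universalGroup F, g • c = c →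
      (∀ t ∉ T, ∀ x : C, col.colour t (g • x) = col.colour t x) → g ∈ N := by
    intro T
    induction T using Finset.induction_on with
    | empty =>
      intro g hg hc hcol
      have : g = 1 := col.aut_ext (c := c) (by rw [hc, one_smul]) (by
        intro s x; rw [hcol s (by simp), one_smul])
      rw [this]; exact one_mem _
    | insert r T hr ih =>
      intro g hg hc hcol
      -- Since `h` acts on r-colours as g does, `g * h⁻¹` preserves them, and it only changes
      -- colours of types in `T`.
      obtain ⟨h, hU, h1, h2, h3⟩ := col.exists_single_colour hg r hc
      have e : g = g * h⁻¹ * h := by group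
      have h1' : h⁻¹ • c = c := by rw [inv_smul_eq_iff, h1]
      rw [e]
      refine mul_mem (ih _ (mul_mem hg (inv_mem hU)) (by rw [mul_smul, h1', hc]) ?_)
        (hN h hU r h1 h3)
      intro t ht x
      rw [mul_smul]
      by_cases htr : t = r
      · subst htr
        rw [← h2, smul_inv_smul]
      · rw [hcol t (by simp [htr, ht]), ← h3 t htr, smul_inv_smul]
  exact key Finset.univ g hg hc (fun t ht => absurd (Finset.mem_univ t) ht)

variable (F)

theorem exists_compl_adj [Nontrivial S] (hΓ : Γᶜ.Connected) (r : S) :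
    ∃ q, r ≠ q ∧ ¬ Γ.Adj r q := by
  obtain ⟨t, ht⟩ := exists_ne r
  obtain ⟨p⟩ := hΓ.preconnected r t
  cases p with
  | nil => exact absurd rfl ht
  | cons h _ => exact ⟨_, (SimpleGraph.compl_adj _ _ _).1 h⟩

theorem ddagger_le_plus : col.ddagger F ≤ col.plus F := by
  refine iSup_le fun s => iSup_le fun c => ?_
  intro g hg
  refine Subgroup.mem_iSup_of_mem c ?_
  rw [MulAction.mem_stabilizer_iff]
  refine (mem_fixingSubgroup_iff _).1 hg c ?_
  rw [mem_treeWall_iff, δ_self]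
  exact one_mem _

theorem plus_le_ddagger [Finite S] [Nontrivial S] (hΓ : Γᶜ.Connected) :
    col.plus F ≤ col.ddagger F := by
  refine iSup_le fun c => ?_
  intro g hg
  have h := col.mem_of_single_colour (F := F) (c := c)
    ((col.ddagger F).map (col.universalGroup F).subtype) ?_ g.2
    (MulAction.mem_stabilizer_iff.1 hg)
  · obtain ⟨g', hg', he⟩ := h
    rwa [← Subtype.ext he]
  · intro g hg r hc hcol
    obtain ⟨q, hne, hq⟩ := exists_compl_adj hΓ r
    refine ⟨⟨g, hg⟩, ?_, rfl⟩
    refine Subgroup.mem_iSup_of_mem q (Subgroup.mem_iSup_of_mem c ?_)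
    rw [mem_fixingSubgroup_iff]
    intro x hx
    exact col.fixes_treeWall hne hq hc hcol hx

theorem plus_eq_ddagger [Finite S] [Nontrivial S] (hΓ : Γᶜ.Connected) :
    col.plus F = col.ddagger F :=
  le_antisymm (col.plus_le_ddagger F hΓ) (col.ddagger_le_plus F)

/-! ### Gluing elements of the universal group -/

variable {F}

/-- A permutation that agrees on each panel with an element of the universal group belongs to
it. -/
theorem exists_of_locally (h : Equiv.Perm C)
    (hloc : ∀ s x, ∃ u ∈ col.universalGroup F, ∀ y ∈ B.panel s x, h y = u • y) :
    ∃ g ∈ col.universalGroup F, ∀ x : C, g • x = h x := by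
  refine ⟨⟨h, ?_⟩, ?_, fun x => rfl⟩
  · refine B.δ_eq_of_adj_preserving B h fun s x y hxy => ?_
    obtain ⟨u, -, hu⟩ := hloc s x
    rw [hu x (B.self_mem_panel s x), hu y (B.mem_panel_of_δ_eq hxy), δ_smul, hxy]
  · intro s x
    obtain ⟨u, hu, hy⟩ := hloc s x
    rw [(col.localAction_eq_iff _ s x (col.localAction u s x)).2]
    · exact hu s x
    · intro d hd
      rw [col.localAction_colour u s x d hd, ← hy d hd]
      rfl

open Classical in
/-- The map that agrees with `u i` outside the `i`-th wing. -/
noncomputable def glue {I : Type*} (p : I → S) (d : I → C) (u : I → B.aut) (x : C) : C :=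
  if h : ∃ i, x ∉ B.wing (p i) (d i) then u h.choose • x else x

section Glue

variable {I : Type*} {p : I → S} {d : I → C} {u : I → B.aut}

theorem glue_of_not_mem
    (hdisj : Pairwise (Function.onFun Disjoint fun i => (B.wing (p i) (d i))ᶜ))
    {i : I} {x : C} (hx : x ∉ B.wing (p i) (d i)) : glue p d u x = u i • x := by
  have h : ∃ i, x ∉ B.wing (p i) (d i) := ⟨i, hx⟩
  rw [glue, dif_pos h]
  have : h.choose = i := by
    by_contra hne
    exact Set.disjoint_left.1 (hdisj hne) h.choose_spec hx
  rw [this]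

theorem glue_of_mem {x : C} (hx : ∀ i, x ∈ B.wing (p i) (d i)) : glue p d u x = x := by
  rw [glue, dif_neg]
  rintro ⟨i, hi⟩
  exact hi (hx i)

theorem glue_inv (hdisj : Pairwise (Function.onFun Disjoint fun i => (B.wing (p i) (d i))ᶜ))
    (hd : ∀ i, u i • d i = d i) (x : C) :
    glue p d u (glue p d (fun i => (u i)⁻¹) x) = x := by
  by_cases h : ∃ i, x ∉ B.wing (p i) (d i)
  · obtain ⟨i, hi⟩ := h
    rw [glue_of_not_mem hdisj hi, glue_of_not_mem hdisj (i := i), smul_inv_smul]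
    rwa [← smul_mem_wing_iff B (u i), smul_inv_smul, hd]
  · push Not at h
    rw [glue_of_mem h, glue_of_mem h]

/-- Membership in U(F) is tested on single panels. A panel crossing the boundary of a half-space has
exactly one chamber in the wing, and `u i` fixes it by `hfix`, so identity and `u i` agree there. -/
theorem exists_glue (hdisj : Pairwise (Function.onFun Disjoint fun i => (B.wing (p i) (d i))ᶜ))
    (hu : ∀ i, u i ∈ col.universalGroup F)
    (hfix : ∀ i x, B.δ (d i) x ∈ Γ.parabolic (Γ.neighborSet (p i)) → u i • x = x) :
    ∃ g ∈ col.universalGroup F, (∀ i, ∀ x ∉ B.wing (p i) (d i), g • x = u i • x) ∧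
      ∀ x, (∀ i, x ∈ B.wing (p i) (d i)) → g • x = x := by
  have hd : ∀ i, u i • d i = d i := fun i => hfix i _ (by rw [δ_self]; exact one_mem _)
  have hd' : ∀ i, (u i)⁻¹ • d i = d i := fun i => by rw [inv_smul_eq_iff, hd]
  let h : Equiv.Perm C := ⟨glue p d u, glue p d (fun i => (u i)⁻¹), by
    intro x
    have := glue_inv (u := fun i => (u i)⁻¹) hdisj hd' x
    simpa using this, glue_inv hdisj hd⟩
  suffices hloc : ∀ s x, ∃ v ∈ col.universalGroup F, ∀ y ∈ B.panel s x, h y = v • y by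
    obtain ⟨g, hg, hgh⟩ := col.exists_of_locally h hloc
    refine ⟨g, hg, fun i x hx => ?_, fun x hx => ?_⟩
    · rw [hgh]; exact glue_of_not_mem hdisj hx
    · rw [hgh]; exact glue_of_mem hx
  intro s x
  by_cases hex : ∃ i, ∃ y ∈ B.panel s x, y ∉ B.wing (p i) (d i)
  · obtain ⟨i, y, hy, hyi⟩ := hex
    refine ⟨u i, hu i, ?_⟩
    by_cases hz : ∃ z ∈ B.panel s x, z ∈ B.wing (p i) (d i)
    · obtain ⟨z, hz, hzi⟩ := hz
      have hpan : ∀ {a b}, a ∈ B.panel s x → b ∈ B.panel s x → b ∈ B.panel s a := fun ha hb =>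
        B.mem_panel_trans (B.mem_panel_symm ha) hb
      obtain ⟨hs, hpar⟩ := B.crossing hzi hyi (hpan hz hy)
      have hout : ∀ a ∈ B.panel s x, a ≠ z → a ∉ B.wing (p i) (d i) := by
        intro a ha hne
        exact B.not_mem_wing_of_mem_panel hpar (hs ▸ hpan hz ha) hne
      intro a ha
      by_cases haz : a = z
      · subst haz
        rw [hfix i a hpar]
        -- If the remaining chamber lies in another half-space, then disjointness leaves only a and
        -- y in the panel. As `u j` fixes y, it must fix a.
        by_cases hj : ∃ j, a ∉ B.wing (p j) (d j)
        · obtain ⟨j, haj⟩ := hj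
          have hij : i ≠ j := by rintro rfl; exact haj hzi
          have hyj : y ∈ B.wing (p j) (d j) := by
            by_contra hyj
            exact Set.disjoint_left.1 (hdisj hij) hyi hyj
          obtain ⟨hs', hpar'⟩ := B.crossing hyj haj (hpan hy hz)
          change glue p d u a = a
          rw [glue_of_not_mem hdisj haj]
          have hyfix := hfix j y hpar'
          have h1 : u j • a ∈ B.panel s y := by
            rw [← hyfix, smul_mem_panel_iff]; exact hpan hy hz
          by_contra hne
          have h2 : u j • a ≠ y := by
            intro h2
            rw [← hyfix] at h2
            rw [MulAction.injective _ h2] at haj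
            exact haj hyj
          exact Set.disjoint_left.1 (hdisj hij) (hout _ (B.mem_panel_trans hy h1) hne)
            (B.not_mem_wing_of_mem_panel hpar' (hs' ▸ h1) h2)
        · push Not at hj
          exact glue_of_mem hj
      · exact glue_of_not_mem hdisj (hout a ha haz)
    · push Not at hz
      exact fun a ha => glue_of_not_mem hdisj (hz a ha)
  · push Not at hex
    refine ⟨1, one_mem _, fun y hy => ?_⟩
    rw [one_smul]
    exact glue_of_mem fun i => hex i y hy

end Glue

end Building.LegalColouring

/-! ### Half-spaces and flips -/

namespace Building

variable {S : Type v} {Γ : SimpleGraph S} {C : Type u} (B : Building Γ.coxeterMatrix C)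

local notation "σ" => CoxeterMatrix.simple (SimpleGraph.coxeterMatrix Γ)
local notation "LD" => CoxeterSystem.IsLeftDescent (SimpleGraph.cs Γ)
local notation "RD" => CoxeterSystem.IsRightDescent (SimpleGraph.cs Γ)

theorem exists_adj_chamber (s : S) (c : C) : ∃ d, B.δ c d = σ s := by
  obtain ⟨d, hd, -⟩ := B.exists_adj_right s c c
  exact ⟨d, hd⟩

theorem residue_trans {J : Set S} {x y z : C} (h : B.δ x y ∈ Γ.parabolic J)
    (h' : B.δ y z ∈ Γ.parabolic J) : B.δ x z ∈ Γ.parabolic J := by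
  refine B.residue_induction (P := fun z => B.δ x z ∈ Γ.parabolic J) h ?_ z h'
  intro t ht a b hab ha
  rcases B.δ_adj_right hab x with h1 | h1
  · rw [h1]; exact mul_mem ha (Γ.simple_mem_parabolic ht)
  · rwa [h1]

theorem residue_symm {J : Set S} {x y : C} (h : B.δ x y ∈ Γ.parabolic J) :
    B.δ y x ∈ Γ.parabolic J := by
  rw [B.δ_symm]; exact inv_mem h

theorem δ_mem_parabolic_of_mem_panel {J : Set S} {s : S} (hs : s ∈ J) {x y : C}
    (h : y ∈ B.panel s x) : B.δ x y ∈ Γ.parabolic J := by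
  rcases h with h | h
  · rw [h]; exact one_mem _
  · rw [h]; exact Γ.simple_mem_parabolic hs

theorem treeWall_symm {s : S} {x y : C} (h : y ∈ B.treeWall s x) : x ∈ B.treeWall s y :=
  B.residue_symm h

theorem treeWall_trans {s : S} {x y z : C} (h : y ∈ B.treeWall s x) (h' : z ∈ B.treeWall s y) :
    z ∈ B.treeWall s x :=
  B.residue_trans h h'

theorem panel_subset_treeWall (s : S) (x : C) : B.panel s x ⊆ B.treeWall s x := fun _ h =>
  B.δ_mem_parabolic_of_mem_panel (Set.mem_insert _ _) h

theorem mem_treeWall_of_mem_parabolic {s : S} {x y : C}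
    (h : B.δ x y ∈ Γ.parabolic (Γ.neighborSet s)) : y ∈ B.treeWall s x :=
  Γ.parabolic_mono (Set.subset_insert _ _) h

/-- Let w be the displacement of x. For an r-neighbour y the displacement would be r w r, with r as
a descent, which W_J forbids, unless r w = w r. -/
theorem displacement_mem_parabolic {n : B.aut} {J : Set S} {r : S} (hr : r ∉ J)
    (h : ∀ x, B.δ x (n • x) ∈ Γ.parabolic J) (x : C) :
    B.δ x (n • x) ∈ Γ.parabolic (Γ.neighborSet r) := by
  obtain ⟨y, hy⟩ := B.exists_adj_chamber r x
  have h1 := Γ.not_isRightDescent_of_mem_parabolic (h x) hr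
  have h2 : B.δ y (n • x) = σ r * B.δ x (n • x) :=
    B.δ_adj_left_of_not_isLeftDescent (B.δ_symm_of_eq_simple hy)
      (Γ.not_isLeftDescent_of_mem_parabolic (h x) hr)
  have h3 : B.δ (n • x) (n • y) = σ r := by rw [δ_smul, hy]
  by_cases h4 : RD (σ r * B.δ x (n • x)) r
  · exact Γ.mem_parabolic_neighborSet (Γ.simple_mul_eq_of_isRightDescent h1 h4) h1
  · have h5 := B.δ_adj_right_of_not_isRightDescent (x := y) h3 (by rwa [h2])
    refine absurd ?_ (Γ.not_isRightDescent_of_mem_parabolic (h y) hr)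
    rw [h5, h2]
    exact isRightDescent_mul h4

theorem _root_.SimpleGraph.forall_of_compl_connected (hΓ : Γᶜ.Connected) {P : S → Prop} {p : S}
    (hp : P p) (hstep : ∀ p q, p ≠ q → ¬ Γ.Adj p q → P p → P q) (q : S) : P q := by
  obtain ⟨l⟩ := hΓ.preconnected p q
  induction l with
  | nil => exact hp
  | cons h l ih =>
    obtain ⟨h1, h2⟩ := (SimpleGraph.compl_adj _ _ _).1 h
    exact ih (hstep _ _ h1 h2 hp)

/-- A non-trivial automorphism moves a tree-wall of any given type. -/
theorem exists_not_mem_treeWall [Nontrivial S] (hΓ : Γᶜ.Connected) {n : B.aut} (hn : n ≠ 1)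
    (s : S) : ∃ x, n • x ∉ B.treeWall s x := by
  by_contra! hall
  obtain ⟨r, hsr, hr⟩ := LegalColouring.exists_compl_adj hΓ s
  have h1 : ∀ p x, B.δ x (n • x) ∈ Γ.parabolic (Γ.neighborSet p) := by
    refine fun p => SimpleGraph.forall_of_compl_connected hΓ (p := r)
      (P := fun p => ∀ x, B.δ x (n • x) ∈ Γ.parabolic (Γ.neighborSet p)) ?_ ?_ p
    · refine B.displacement_mem_parabolic ?_ hall
      rintro (h | h)
      · exact hsr h.symm
      · exact hr h
    -- Along the connected complement graph the displacements enter W_{p^⊥} for every p. They then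
    -- have no descent at all, so n = 1.
    · exact fun p q _ hpq h => B.displacement_mem_parabolic hpq h
  refine hn (Subtype.ext (Equiv.ext fun x => ?_))
  by_contra hx
  have h2 : B.δ x (n • x) ≠ 1 := fun h => hx ((B.δ_eq_one_iff _ _).1 h).symm
  obtain ⟨p, hp⟩ := Γ.cs.exists_rightDescent_of_ne_one h2
  exact Γ.not_isRightDescent_of_mem_parabolic (h1 p x) Γ.irrefl hp

theorem mem_wing_of_not_isRightDescent {s : S} {x p : C} (h : ¬ RD (B.δ x p) s) :
    x ∈ B.wing s p := by
  rwa [mem_wing_iff, B.δ_symm, CoxeterSystem.isLeftDescent_inv_iff]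

theorem exists_wing_of_panel (s : S) (x c : C) : ∃ p ∈ B.panel s c, x ∈ B.wing s p := by
  obtain ⟨p, hp, h, -⟩ := B.exists_proj s x c
  exact ⟨p, hp, B.mem_wing_of_not_isRightDescent h⟩

/-- Two panels in different tree-walls of type `s` have disjoint complements of wings facing away
from each other. -/
theorem exists_disjoint_of_not_mem_treeWall {s : S} {x y : C} (h : y ∉ B.treeWall s x) :
    ∃ e ∈ B.panel s x, ∃ f ∈ B.panel s y, Disjoint (B.wing s e)ᶜ (B.wing s f)ᶜ := by
  obtain ⟨e, he, hye⟩ := B.exists_wing_of_panel s y x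
  obtain ⟨f, hf, hxf⟩ := B.exists_wing_of_panel s x y
  have hxe := B.panel_subset_treeWall s x he
  have hyf := B.panel_subset_treeWall s y hf
  refine ⟨e, he, f, hf, B.disjoint_compl_wing ?_ ?_ fun h3 => ?_⟩
  · by_contra h1
    exact h (B.treeWall_trans hxe (B.mem_treeWall_of_mem_parabolic (B.crossing hye h1 hf).2))
  · by_contra h1
    exact h (B.treeWall_symm (B.treeWall_trans hyf
      (B.mem_treeWall_of_mem_parabolic (B.crossing hxf h1 he).2)))
  · exact h (B.treeWall_trans hxe (B.treeWall_trans (B.mem_treeWall_of_mem_parabolic h3)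
      (B.treeWall_symm hyf)))

/-- A half-space bounded by a tree-wall that does not contain `y` is nested with the wing of
`y`. -/
theorem nested_of_not_mem_treeWall {s : S} {d y : C} (h : y ∈ B.wing s d)
    (h' : y ∉ B.treeWall s d) :
    (B.wing s d)ᶜ ⊆ B.wing s y ∨ (B.wing s d)ᶜ ⊆ (B.wing s y)ᶜ := by
  by_cases hd : d ∈ B.wing s y
  · left
    rw [← Set.disjoint_compl_right_iff_subset]
    exact B.disjoint_compl_wing h hd fun h3 => h' (B.mem_treeWall_of_mem_parabolic h3)
  · right
    obtain ⟨e, he, hde⟩ := B.exists_wing_of_panel s d y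
    have hye : y ≠ e := by rintro rfl; exact hd hde
    have hey : B.δ e y = σ s := B.δ_eq_simple_of_mem_panel (B.mem_panel_symm he) hye
    have h1 : ∀ (h3 : B.δ d y ∈ Γ.parabolic (Γ.neighborSet s)), False := fun h3 =>
      h' (B.mem_treeWall_of_mem_parabolic h3)
    have h2 : e ∈ B.wing s d := by
      by_contra h3
      exact h1 (B.crossing h h3 he).2
    have h3 : B.δ d e ∉ Γ.parabolic (Γ.neighborSet s) := fun h3 =>
      h' (B.treeWall_trans (B.mem_treeWall_of_mem_parabolic h3)
        (B.treeWall_symm (B.panel_subset_treeWall s y he)))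
    exact ((B.disjoint_compl_wing h2 hde h3).mono_right
      (B.wing_subset_compl_wing hey)).subset_compl_right

theorem exists_compl_wing_subset (hΓ : Γᶜ.Connected) (s p : S) (c : C) :
    ∃ d, (B.wing s d)ᶜ ⊆ (B.wing p c)ᶜ := by
  obtain ⟨l⟩ := hΓ.preconnected p s
  induction l generalizing c with
  | nil => exact ⟨c, subset_rfl⟩
  | cons h l ih =>
    obtain ⟨h1, h2⟩ := (SimpleGraph.compl_adj _ _ _).1 h
    obtain ⟨e, he⟩ := B.exists_adj_chamber _ c
    obtain ⟨d, hd⟩ := ih e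
    exact ⟨d, hd.trans (B.compl_wing_subset_compl_wing h1 h2 he)⟩

end Building

namespace Building.LegalColouring

variable {S : Type v} {Γ : SimpleGraph S} {C : Type u} {B : Building Γ.coxeterMatrix C}
  {Ω : S → Type w} (col : B.LegalColouring Ω) {F : ∀ s : S, Subgroup (Equiv.Perm (Ω s))}

local notation "σ" => CoxeterMatrix.simple (SimpleGraph.coxeterMatrix Γ)

include col in
/-- A half-space contains two disjoint half-spaces of a non-commuting type. -/
theorem exists_disjoint_half_spaces {r s : S} (hne : r ≠ s) (hr : ¬ Γ.Adj r s)
    {a b e : Ω s} (hab : a ≠ b) (hae : a ≠ e) (hbe : b ≠ e) (c : C) :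
    ∃ x y, (B.wing r x)ᶜ ⊆ (B.wing s c)ᶜ ∧ (B.wing r y)ᶜ ⊆ (B.wing s c)ᶜ ∧
      Disjoint (B.wing r x)ᶜ (B.wing r y)ᶜ := by
  obtain ⟨a', b', h1, h2, h3⟩ : ∃ a' b' : Ω s, a' ≠ b' ∧ col.colour s c ≠ a' ∧
      col.colour s c ≠ b' := by
    by_cases ha : col.colour s c = a
    · exact ⟨b, e, hbe, by rwa [ha], by rwa [ha]⟩
    by_cases hb : col.colour s c = b
    · exact ⟨a, e, hae, ha, by rwa [hb]⟩
    · exact ⟨a, b, hab, ha, hb⟩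
  have hsr : ¬ Γ.Adj s r := fun h => hr h.symm
  refine ⟨col.move s a' c, col.move s b' c,
    B.compl_wing_subset_compl_wing hne.symm hsr (col.δ_move h2),
    B.compl_wing_subset_compl_wing hne.symm hsr (col.δ_move h3), ?_⟩
  have h4 : B.δ (col.move s a' c) (col.move s b' c) = σ s := by
    have := col.δ_move (s := s) (a := b') (c := col.move s a' c) (by rwa [colour_move])
    rwa [move_move] at this
  refine B.disjoint_compl_wing ?_ ?_ ?_
  · rw [mem_wing_iff, h4]; exact mt Γ.isLeftDescent_simple_iff.1 hne.symm
  · rw [mem_wing_iff, B.δ_symm_of_eq_simple h4]; exact mt Γ.isLeftDescent_simple_iff.1 hne.symm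
  · rw [h4]; exact mt Γ.simple_mem_parabolic_iff.1 hr

include col in
/-- A half-space contains a half-space that is bounded by a tree-wall avoiding a given chamber. -/
theorem exists_compl_wing_avoiding (hΓ : Γᶜ.Connected) {r s : S} (hne : r ≠ s)
    (hr : ¬ Γ.Adj r s) {a b e : Ω s} (hab : a ≠ b) (hae : a ≠ e) (hbe : b ≠ e) (p : S)
    (c y : C) : ∃ d, (B.wing s d)ᶜ ⊆ (B.wing p c)ᶜ ∧ y ∈ B.wing s d ∧ y ∉ B.treeWall s d := by
  obtain ⟨c', hc'⟩ := B.exists_compl_wing_subset hΓ s p c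
  obtain ⟨x₁, x₂, h1, h2, h3⟩ := col.exists_disjoint_half_spaces hne hr hab hae hbe c'
  have key : ∀ x, (B.wing r x)ᶜ ⊆ (B.wing s c')ᶜ → y ∉ (B.wing r x)ᶜ →
      ∃ d, (B.wing s d)ᶜ ⊆ (B.wing p c)ᶜ ∧ y ∈ B.wing s d ∧ y ∉ B.treeWall s d := by
    intro x hx hy
    obtain ⟨d, hd⟩ := B.exists_adj_chamber r x
    have h4 := B.compl_wing_subset_compl_wing hne hr hd
    refine ⟨d, h4.trans (hx.trans hc'), ?_, fun h => hy (B.treeWall_subset_compl_wing hne hr hd h)⟩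
    by_contra h5
    exact hy (h4 h5)
  by_cases hy : y ∈ (B.wing r x₁)ᶜ
  · exact key x₂ h2 (Set.disjoint_left.1 h3 hy)
  · exact key x₁ h1 hy

/-- A half-space contains a wing of a given colour. -/
theorem exists_wing_subset {r s : S} (hne : r ≠ s) (hr : ¬ Γ.Adj r s) {a b : Ω s} (hab : b ≠ a)
    (c : C) : ∃ d, col.colour s d = a ∧ B.wing s d ⊆ (B.wing s c)ᶜ := by
  by_cases h : col.colour s c = a
  · have h1 : B.δ c (col.move s b c) = σ s := col.δ_move (by rw [h]; exact hab.symm)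
    obtain ⟨c', hc'⟩ := B.exists_adj_chamber r (col.move s b c)
    have h2 : col.colour s c' = b := by
      rw [col.constant_on_panel s r hne _ _ (B.mem_panel_of_δ_eq hc'), colour_move]
    have h3 : B.δ c' (col.move s a c') = σ s := col.δ_move (by rwa [h2])
    refine ⟨col.move s a c', col.colour_move _ _ _, ?_⟩
    exact (B.wing_subset_compl_wing h3).trans ((B.compl_wing_subset_compl_wing hne hr hc').trans
      (B.compl_wing_subset_compl_wing hne.symm (fun h => hr h.symm) h1))
  · exact ⟨col.move s a c, col.colour_move _ _ _, B.wing_subset_compl_wing (col.δ_move h)⟩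

/-- A wing whose colour is moved by a point stabilizer is flipped by a chamber stabilizer. -/
theorem exists_flip {r s : S} (hne : r ≠ s) (hr : ¬ Γ.Adj r s) {f : Equiv.Perm (Ω s)}
    (hf : f ∈ F s) {z a : Ω s} (hz : f z = z) (ha : f a ≠ a) {d : C}
    (hd : col.colour s d = a) : ∃ k ∈ col.universalGroup F, (∃ c : C, k • c = c) ∧
      ∀ x ∉ B.wing s d, k • x ∈ B.wing s d := by
  obtain ⟨e, he⟩ := B.exists_adj_chamber r d
  have hea : col.colour s e = a := by
    rw [col.constant_on_panel s r hne _ _ (B.mem_panel_of_δ_eq he), hd]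
  have hza : z ≠ a := by rintro rfl; exact ha hz
  obtain ⟨k, hk, hkc, hks, -⟩ := col.exists_of_perm (F := F) hf (c := col.move s z e)
    (d := col.move s z e) (by rw [colour_move, hz]) (fun _ _ => rfl)
  refine ⟨k, hk, ⟨_, hkc⟩, ?_⟩
  have h1 : B.δ e (k • e) = σ s := by
    have h2 : e ∈ B.panel s (col.move s z e) := B.mem_panel_symm (col.move_mem s z e)
    have h3 := (B.smul_mem_panel_iff k s _ _).2 h2
    rw [hkc] at h3
    refine B.δ_eq_simple_of_mem_panel (B.mem_panel_trans (col.move_mem s z e) h3) ?_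
    intro h4
    have h5 := hks e
    rw [h4, hea] at h5
    exact ha h5.symm
  have h2 : B.δ d (k • d) = σ r * σ s * σ r := by
    have h3 : B.δ d (k • e) = σ r * σ s := by
      rw [B.δ_adj_right_of_not_isRightDescent h1, he]
      rw [he]; exact mt Γ.isRightDescent_simple_iff.1 hne
    have h4 : B.δ (k • e) (k • d) = σ r := by rw [δ_smul, B.δ_symm_of_eq_simple he]
    rw [B.δ_adj_right_of_not_isRightDescent h4, h3]
    rw [h3, ← CoxeterSystem.isLeftDescent_inv_iff, mul_inv_rev, CoxeterMatrix.simple_inv,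
      CoxeterMatrix.simple_inv]
    intro h5
    exact hr (Γ.adj_of_isLeftDescent hne h5 (isLeftDescent_mul
      (mt Γ.isLeftDescent_simple_iff.1 hne)))
  obtain ⟨h3, h4⟩ := Γ.not_isLeftDescent_conj hne hr
  have h5 : B.δ (k • d) d = σ r * σ s * σ r := by
    rw [B.δ_symm, h2]
    simp only [mul_inv_rev, CoxeterMatrix.simple_inv, mul_assoc]
  have h6 : Disjoint (B.wing s d)ᶜ (B.wing s (k • d))ᶜ := by
    refine B.disjoint_compl_wing ?_ ?_ ?_
    · rwa [mem_wing_iff, h2]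
    · rwa [mem_wing_iff, h5]
    · rw [h2]
      intro h7
      exact Γ.not_isLeftDescent_of_mem_parabolic h7 (fun h => hr (show Γ.Adj s r from h).symm) h3
  intro x hx
  by_contra hkx
  refine Set.disjoint_left.1 h6 hkx ?_
  rwa [Set.mem_compl_iff, smul_mem_wing_iff]

/-! ### Subgroups normalized by chamber stabilizers. -/

section Normal

variable {N : Subgroup B.aut} (hN : N ≤ col.universalGroup F)
  (hconj : ∀ g ∈ col.universalGroup F, (∃ c : C, g • c = c) → ∀ n ∈ N, g * n * g⁻¹ ∈ N)

include hN hconj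

/-- If the translates of a half-space under the powers of `n` are disjoint, then the group of
elements supported in the half-space consists of commutators with `n`. -/
theorem mem_of_wandering {n : B.aut} (hn : n ∈ N) {s : S} {y x₀ : C}
    (hdisj : Pairwise (Function.onFun Disjoint fun i : ℕ => (B.wing s (n ^ i • y))ᶜ))
    (hx₀ : ∀ i : ℕ, x₀ ∈ B.wing s (n ^ i • y)) {k : B.aut} (hk : k ∈ col.universalGroup F)
    (hfix : ∀ x ∈ B.wing s y, k • x = x) : k ∈ N := by
  -- The infinite product of all n^i k n^{-i} with i ≥ 0. Conjugation by n removes the factor i = 0,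
  -- so h = k · n h n⁻¹ and k = [h, n].
  obtain ⟨h, hU, h1, h2⟩ := col.exists_glue (F := F) (p := fun _ : ℕ => s)
    (d := fun i : ℕ => n ^ i • y) (u := fun i => n ^ i * k * (n ^ i)⁻¹) hdisj
    (fun i => mul_mem (mul_mem (pow_mem (hN hn) i) hk) (inv_mem (pow_mem (hN hn) i))) (by
      intro i x hx
      have hx' := B.mem_wing_of_mem_parabolic hx
      rw [← smul_inv_smul (n ^ i) x, smul_mem_wing_iff] at hx'
      rw [mul_smul, mul_smul, hfix _ hx', smul_inv_smul])
  have hshift : ∀ (i : ℕ) (x : C), n • x ∈ B.wing s (n ^ (i + 1) • y) ↔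
      x ∈ B.wing s (n ^ i • y) := by
    intro i x
    rw [pow_succ', mul_smul, smul_mem_wing_iff]
  have hzero : ∀ (i : ℕ) (x : C), x ∉ B.wing s (n ^ (i + 1) • y) → k • x = x := by
    intro i x hx
    refine hfix x ?_
    by_contra hx0
    refine Set.disjoint_left.1 (hdisj (Nat.succ_ne_zero i)) hx ?_
    simpa using hx0
  have key : h * n = k * n * h := by
    refine Subtype.ext (Equiv.ext fun x => ?_)
    change h • (n • x) = k • (n • (h • x))
    by_cases hx : ∃ i : ℕ, x ∉ B.wing s (n ^ i • y)
    · obtain ⟨i, hi⟩ := hx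
      have hi' := mt (hshift i x).1 hi
      rw [h1 i x hi, h1 (i + 1) _ hi']
      have e : n • ((n ^ i * k * (n ^ i)⁻¹) • x) =
          (n ^ (i + 1) * k * (n ^ (i + 1))⁻¹) • (n • x) := by
        simp only [← mul_smul]
        congr 1
        rw [pow_succ']
        group
      rw [e, eq_comm]
      refine hzero i _ ?_
      have h3 : n ^ (i + 1) • y = (n ^ (i + 1) * k * (n ^ (i + 1))⁻¹) • (n ^ (i + 1) • y) := by
        rw [mul_smul, mul_smul, inv_smul_smul, hfix y (B.self_mem_wing s y)]
      rw [h3, smul_mem_wing_iff]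
      exact hi'
    · push Not at hx
      rw [h2 x hx]
      by_cases h0 : n • x ∈ B.wing s y
      · rw [hfix _ h0]
        refine h2 _ fun i => ?_
        cases i with
        | zero => simpa using h0
        | succ i => rw [hshift]; exact hx i
      · have := h1 0 (n • x) (by simpa using h0)
        simpa using this
  have e : k = h * n * h⁻¹ * n⁻¹ := by rw [key]; group
  rw [e]
  exact mul_mem (hconj h hU ⟨x₀, h2 x₀ hx₀⟩ n hn) (inv_mem hn)

variable [Nontrivial S] (hΓ : Γᶜ.Connected) {s : S} {f : Equiv.Perm (Ω s)} (hf : f ∈ F s)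
  {z a : Ω s} (hz : f z = z) (ha : f a ≠ a)

include hΓ hf hz ha

/-- Ping-pong: a commutator of a non-trivial element of N with a flip sends some half-space to
disjoint translates, so that `mem_of_wandering` applies. -/
theorem exists_half_space_le (hN1 : N ≠ ⊥) : ∃ y : C, ∀ k ∈ col.universalGroup F,
    (∀ x ∈ B.wing s y, k • x = x) → k ∈ N := by
  obtain ⟨r, hsr, hr⟩ := exists_compl_adj hΓ s
  have hr' : ¬ Γ.Adj r s := fun h => hr h.symm
  have hza : z ≠ a := by rintro rfl; exact ha hz
  have hzb : z ≠ f a := fun h => hza (f.injective (hz.trans h))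
  have haf : a ≠ f a := fun h => ha h.symm
  obtain ⟨⟨n₀, hn₀⟩, hn₀1⟩ := (Subgroup.ne_bot_iff_exists_ne_one).1 hN1
  have hn₀1 : n₀ ≠ 1 := fun h => hn₀1 (Subtype.ext h)
  obtain ⟨x, hx⟩ := B.exists_not_mem_treeWall hΓ hn₀1 s
  obtain ⟨e, he, e', he', hee'⟩ := B.exists_disjoint_of_not_mem_treeWall hx
  -- Two chambers of the panel are forbidden, and the colours z, a and f a are distinct.
  obtain ⟨d₀, hd₀x, hd₀e, hd₀e'⟩ : ∃ d₀ ∈ B.panel s x, d₀ ≠ e ∧ n₀ • d₀ ≠ e' := by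
    have key : ∀ b : Ω s, col.colour s e ≠ b → col.colour s (n₀⁻¹ • e') ≠ b →
        ∃ d₀ ∈ B.panel s x, d₀ ≠ e ∧ n₀ • d₀ ≠ e' := by
      intro b h1 h2
      refine ⟨col.move s b x, col.move_mem s b x, ?_, ?_⟩
      · rintro rfl; exact h1 (col.colour_move s b x)
      · rintro rfl; exact h2 (by rw [inv_smul_smul, colour_move])
    by_contra hno
    have h1 := fun b => not_and_or.1 fun h => hno (key b h.1 h.2)
    simp only [not_not] at h1
    have hz1 := h1 z
    have ha1 := h1 a
    have hf1 := h1 (f a)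
    grind
  have hD : Disjoint (B.wing s d₀) (B.wing s (n₀ • d₀)) := by
    refine hee'.mono (B.wing_subset_compl_wing ?_) (B.wing_subset_compl_wing ?_)
    · exact B.δ_eq_simple_of_mem_panel (B.mem_panel_trans (B.mem_panel_symm he) hd₀x) hd₀e
    · exact B.δ_eq_simple_of_mem_panel (B.mem_panel_trans (B.mem_panel_symm he')
        ((B.smul_mem_panel_iff n₀ s _ _).2 hd₀x)) hd₀e'
  obtain ⟨c', hc'⟩ := B.exists_compl_wing_subset hΓ s r d₀
  replace hc' := hc'.trans (B.compl_wing_subset_wing hsr hr d₀)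
  -- Inside the wing of `d₀`, one of two disjoint half-spaces receives the wing of colour a to be
  -- flipped, the other the half-space that will wander.
  obtain ⟨x₁, x₂, h1, h2, h3⟩ := col.exists_disjoint_half_spaces hsr.symm hr' hza hzb haf c'
  obtain ⟨c₁, hc₁⟩ := B.exists_compl_wing_subset hΓ s r x₁
  obtain ⟨d, hda, hd⟩ := col.exists_wing_subset hsr.symm hr' hza c₁
  obtain ⟨y, hy⟩ := B.exists_compl_wing_subset hΓ s r x₂
  have hdy : Disjoint (B.wing s d) (B.wing s y)ᶜ := h3.mono (hd.trans hc₁) hy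
  have hdd : B.wing s d ⊆ B.wing s d₀ := hd.trans (hc₁.trans (h1.trans hc'))
  have hyd : (B.wing s y)ᶜ ⊆ B.wing s d₀ := hy.trans (h2.trans hc')
  obtain ⟨k, hk, ⟨c, hkc⟩, hflip⟩ := col.exists_flip hsr.symm hr' hf hz ha hda
  have hflip' : ∀ x ∉ B.wing s d, k⁻¹ • x ∈ B.wing s d := by
    intro x hx
    by_contra h
    have := hflip _ h
    rw [smul_inv_smul] at this
    exact hx this
  have hn₀d : ∀ x ∈ B.wing s (n₀ • d), x ∈ B.wing s (n₀ • d₀) := by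
    intro x hx
    rw [← smul_inv_smul n₀ x, smul_mem_wing_iff] at hx ⊢
    exact hdd hx
  have hn₀H : ∀ x ∈ B.wing s (n₀ • d), x ∉ B.wing s d := fun x hx hx' =>
    Set.disjoint_left.1 hD (hdd hx') (hn₀d x hx)
  have hn₀Y : ∀ x ∈ B.wing s (n₀ • d), x ∈ B.wing s y := fun x hx => by
    by_contra hx'
    exact Set.disjoint_left.1 hD (hyd hx') (hn₀d x hx)
  have hYH : ∀ x ∉ B.wing s y, x ∉ B.wing s d := fun x hx hx' => Set.disjoint_left.1 hdy hx' hx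
  -- Outside the wing of d, the map k⁻¹ leads into it, n₀⁻¹ out again, k back in, and n₀ into the
  -- wing of `n₀ • d`, which is disjoint from the wing of d. So all positive powers of n map the
  -- outside there, and that wing avoids the half-space of y.
  let n := n₀ * (k * n₀⁻¹ * k⁻¹)
  have hn : n ∈ N := mul_mem hn₀ (hconj k hk ⟨c, hkc⟩ _ (inv_mem hn₀))
  have hnH : ∀ x ∉ B.wing s d, n • x ∈ B.wing s (n₀ • d) := by
    intro x hx
    simp only [n, mul_smul]
    rw [smul_mem_wing_iff]
    refine hflip _ fun h => ?_
    refine hn₀H (k⁻¹ • x) ?_ (hflip' x hx)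
    rwa [← smul_inv_smul n₀ (k⁻¹ • x), smul_mem_wing_iff]
  have hpow : ∀ (m : ℕ) (x : C), x ∉ B.wing s d → n ^ (m + 1) • x ∈ B.wing s (n₀ • d) := by
    intro m x hx
    induction m with
    | zero => simpa using hnH x hx
    | succ m ih =>
      rw [pow_succ', mul_smul]
      exact hnH _ (hn₀H _ ih)
  have hlt : ∀ (i j : ℕ) (x : C), i < j → x ∉ B.wing s (n ^ i • y) →
      x ∈ B.wing s (n ^ j • y) := by
    intro i j x hij hx
    by_contra hxj
    obtain ⟨m, rfl⟩ := Nat.exists_eq_add_of_lt hij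
    rw [← smul_inv_smul (n ^ (i + m + 1)) x, smul_mem_wing_iff] at hxj
    have h4 := hn₀Y _ (hpow m _ (hYH _ hxj))
    rw [← smul_mem_wing_iff B (n ^ i), ← mul_smul, ← pow_add, ← add_assoc, smul_inv_smul] at h4
    exact hx h4
  refine ⟨y, fun k hk hfix => col.mem_of_wandering hN hconj hn (s := s) (y := y) (x₀ := d)
    ?_ ?_ hk hfix⟩
  · intro i j hij
    rw [Function.onFun, Set.disjoint_left]
    intro x hx hx'
    rcases lt_or_gt_of_ne hij with h | h
    · exact hx' (hlt i j x h hx)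
    · exact hx (hlt j i x h hx')
  · intro i
    cases i with
    | zero =>
      rw [pow_zero, one_smul]
      by_contra h
      exact hYH d h (B.self_mem_wing s d)
    | succ i =>
      by_contra h
      rw [← smul_inv_smul (n ^ (i + 1)) d, smul_mem_wing_iff] at h
      have h4 := hpow i _ (hYH _ h)
      rw [smul_inv_smul] at h4
      exact hn₀H _ h4 (B.self_mem_wing s d)

omit hN in
-- The flip of d maps the support of k into the wing of d, hence into the half-space of y already
-- controlled by N; conjugating back returns k.
theorem mem_of_flip {y : C} (hy : ∀ k ∈ col.universalGroup F, (∀ x ∈ B.wing s y, k • x = x) →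
    k ∈ N) {p : S} {c d : C} (hd : col.colour s d = a) (h1 : B.wing s d ⊆ (B.wing s y)ᶜ)
    (h2 : B.wing s d ⊆ B.wing p c) {k : B.aut} (hk : k ∈ col.universalGroup F)
    (hfix : ∀ x ∈ B.wing p c, k • x = x) : k ∈ N := by
  obtain ⟨r, hsr, hr⟩ := exists_compl_adj hΓ s
  obtain ⟨u, hu, ⟨b, hb⟩, hflip⟩ := col.exists_flip hsr.symm (fun h => hr h.symm) hf hz ha hd
  have h3 : u * k * u⁻¹ ∈ N := by
    refine hy _ (mul_mem (mul_mem hu hk) (inv_mem hu)) fun x hx => ?_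
    rw [mul_smul, mul_smul, hfix, smul_inv_smul]
    by_contra h
    have h4 := hflip _ fun h' => h (h2 h')
    rw [smul_inv_smul] at h4
    exact h1 h4 hx
  have h4 := hconj u⁻¹ (inv_mem hu) ⟨b, by rw [inv_smul_eq_iff, hb]⟩ _ h3
  simpa [mul_assoc] using h4

/-- Once a half-space on which N is known to contain everything shares a suitable wing with the wing
of c, `mem_of_flip` finishes. If the chosen half-space in the wing of c faces away from y, a flip
first carries the half-space of y into the wing of c. -/
theorem mem_of_fixes_wing (hN1 : N ≠ ⊥) {p : S} {c : C} {k : B.aut}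
    (hk : k ∈ col.universalGroup F) (hfix : ∀ x ∈ B.wing p c, k • x = x) : k ∈ N := by
  obtain ⟨r, hsr, hr⟩ := exists_compl_adj hΓ s
  have hr' : ¬ Γ.Adj r s := fun h => hr h.symm
  have hza : z ≠ a := by rintro rfl; exact ha hz
  have hzb : z ≠ f a := fun h => hza (f.injective (hz.trans h))
  have haf : a ≠ f a := fun h => ha h.symm
  obtain ⟨y, hy⟩ := col.exists_half_space_le hN hconj hΓ hf hz ha hN1
  obtain ⟨q, hpq, hq⟩ := exists_compl_adj hΓ p
  have hqp := B.compl_wing_subset_wing hpq hq c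
  obtain ⟨d₁, hd₁, hyd, hyd'⟩ := col.exists_compl_wing_avoiding hΓ hsr.symm hr' hza hzb haf q c y
  obtain ⟨d, hda, hd⟩ := col.exists_wing_subset hsr.symm hr' hza d₁
  have hdp := hd.trans (hd₁.trans hqp)
  rcases B.nested_of_not_mem_treeWall hyd hyd' with h | h
  · obtain ⟨v, hv, ⟨b, hb⟩, hflip⟩ := col.exists_flip hsr.symm hr' hf hz ha hda
    have hvy : ∀ k ∈ col.universalGroup F, (∀ x ∈ B.wing s (v • y), k • x = x) → k ∈ N := by
      intro k hk hkf
      have h3 : v⁻¹ * k * v ∈ N := by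
        refine hy _ (mul_mem (mul_mem (inv_mem hv) hk) hv) fun x hx => ?_
        rw [mul_smul, mul_smul, hkf _ ((B.smul_mem_wing_iff v s y x).2 hx), inv_smul_smul]
      have h4 := hconj v hv ⟨b, hb⟩ _ h3
      simpa [mul_assoc] using h4
    obtain ⟨d₂, hd₂a, hd₂⟩ := col.exists_wing_subset hsr.symm hr' hza (v • y)
    refine col.mem_of_flip hconj hΓ hf hz ha hvy hd₂a hd₂ ?_ hk hfix
    intro x hx
    have h5 := hd₂ hx
    rw [Set.mem_compl_iff, ← smul_inv_smul v x, smul_mem_wing_iff] at h5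
    have h6 := hflip (v⁻¹ • x) fun h' => h5 (h (hd h'))
    rw [smul_inv_smul] at h6
    exact hdp h6
  · exact col.mem_of_flip hconj hΓ hf hz ha hy hda (hd.trans h) hdp hk hfix

/-- A non-trivial subgroup normalized by all chamber stabilizers contains them. -/
theorem mem_of_fixes_chamber [Finite S] (hN1 : N ≠ ⊥) {g : B.aut}
    (hg : g ∈ col.universalGroup F) {c : C} (hc : g • c = c) : g ∈ N := by
  refine col.mem_of_single_colour (F := F) N (c := c) ?_ hg hc
  intro g hg r hc hcol
  obtain ⟨q, hrq, hq⟩ := exists_compl_adj hΓ r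
  -- The element g fixes the q-tree-wall of c, so it can be cut there: h is g on the half-space and
  -- trivial on the wing, and `h⁻¹ * g` is trivial on the half-space.
  obtain ⟨h, hU, h1, h2⟩ := col.exists_glue (F := F) (I := Unit) (p := fun _ => q)
    (d := fun _ => c) (u := fun _ => g) (fun i j hij => absurd rfl hij) (fun _ => hg)
    (fun _ x hx => col.fixes_treeWall hrq hq hc hcol (B.mem_treeWall_of_mem_parabolic hx))
  have h3 : h ∈ N := col.mem_of_fixes_wing hN hconj hΓ hf hz ha hN1 (p := q) (c := c) hU
    fun x hx => h2 x fun _ => hx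
  obtain ⟨c', hc'⟩ := B.exists_adj_chamber q c
  have h4 : h⁻¹ * g ∈ N := by
    refine col.mem_of_fixes_wing hN hconj hΓ hf hz ha hN1 (p := q) (c := c')
      (mul_mem (inv_mem hU) hg) fun x hx => ?_
    rw [mul_smul, inv_smul_eq_iff, h1 () x (B.wing_subset_compl_wing hc' hx)]
  have h5 := mul_mem h3 h4
  rwa [mul_inv_cancel_left] at h5

end Normal

end Building.LegalColouring

/-! ### Simplicity -/

namespace Building.LegalColouring

variable {S : Type v} {Γ : SimpleGraph S} {C : Type u} {B : Building Γ.coxeterMatrix C}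
  {Ω : S → Type w} (col : B.LegalColouring Ω) {F : ∀ s : S, Subgroup (Equiv.Perm (Ω s))}

theorem mem_plus_of_fixes {g : col.universalGroup F} {c : C} (h : g • c = c) : g ∈ col.plus F :=
  Subgroup.mem_iSup_of_mem c (MulAction.mem_stabilizer_iff.2 h)

theorem exists_perm_of_not_actsFreely {X : Type w} {Y : Subgroup (Equiv.Perm X)}
    (h : ¬ Y.ActsFreely) : ∃ f ∈ Y, ∃ z a : X, f z = z ∧ f a ≠ a := by
  simp only [Subgroup.ActsFreely, not_forall] at h
  obtain ⟨f, hf, z, hz, h1⟩ := h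
  by_contra! hno
  exact h1 (Equiv.ext fun a => hno f hf z a hz)

theorem plus_ne_bot {s : S} (hs : ¬ (F s).ActsFreely) : col.plus F ≠ ⊥ := by
  obtain ⟨f, hf, z, a, hz, ha⟩ := exists_perm_of_not_actsFreely hs
  obtain ⟨c⟩ := B.nonempty
  obtain ⟨h, hU, h1, h2, -⟩ := col.exists_of_perm (F := F) hf (c := col.move s z c)
    (d := col.move s z c) (by rw [colour_move, hz]) (fun _ _ => rfl)
  intro hbot
  have h3 : (⟨h, hU⟩ : col.universalGroup F) ∈ col.plus F := col.mem_plus_of_fixes h1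
  rw [hbot, Subgroup.mem_bot] at h3
  have h4 : h = 1 := congrArg Subtype.val h3
  have h5 := h2 (col.move s a c)
  rw [h4, one_smul, colour_move] at h5
  exact ha h5.symm

variable [Finite S] [Nontrivial S] (hΓ : Γᶜ.Connected)

include hΓ

/-- A non-trivial subgroup normalized by `U(F)⁺` contains it. -/
theorem plus_le_of_normalized {s : S} (hs : ¬ (F s).ActsFreely)
    {N : Subgroup (col.universalGroup F)} (hN1 : N ≠ ⊥)
    (hN : ∀ g ∈ col.plus F, ∀ n ∈ N, g * n * g⁻¹ ∈ N) : col.plus F ≤ N := by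
  obtain ⟨f, hf, z, a, hz, ha⟩ := exists_perm_of_not_actsFreely hs
  refine iSup_le fun c g hg => ?_
  have h := col.mem_of_fixes_chamber (F := F) (N := N.map (col.universalGroup F).subtype)
    (Subgroup.map_subtype_le N) ?_ hΓ hf hz ha ?_ g.2 (MulAction.mem_stabilizer_iff.1 hg)
  · obtain ⟨g', hg', he⟩ := h
    rwa [← Subtype.ext he]
  · rintro g hg ⟨c, hc⟩ _ ⟨n, hn, rfl⟩
    exact ⟨_, hN ⟨g, hg⟩ (col.mem_plus_of_fixes hc) n hn, rfl⟩
  · rwa [Ne, Subgroup.map_eq_bot_iff_of_injective _ (Subgroup.subtype_injective _)]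

theorem monolith_eq_plus {s : S} (hs : ¬ (F s).ActsFreely) :
    monolith (col.universalGroup F) = col.plus F := by
  refine le_antisymm (sInf_le ⟨col.plus_normal F, col.plus_ne_bot hs⟩) (le_sInf ?_)
  rintro N ⟨hN, hN1⟩
  exact col.plus_le_of_normalized hΓ hs hN1 fun g _ n hn => hN.conj_mem n hn g

theorem isMonolithic {s : S} (hs : ¬ (F s).ActsFreely) :
    IsMonolithic (col.universalGroup F) := by
  rw [IsMonolithic, col.monolith_eq_plus hΓ hs]
  exact col.plus_ne_bot hs

/-- A normal subgroup of U(F)⁺ need only be normalized by U(F)⁺, which is all that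
`plus_le_of_normalized` requires. -/
theorem isSimpleGroup_plus {s : S} (hs : ¬ (F s).ActsFreely) : IsSimpleGroup (col.plus F) := by
  have hnt : Nontrivial (col.plus F) := (Subgroup.nontrivial_iff_ne_bot _).2 (col.plus_ne_bot hs)
  refine ⟨fun M hM => or_iff_not_imp_left.2 fun hM1 => ?_⟩
  have h := col.plus_le_of_normalized hΓ hs (N := M.map (col.plus F).subtype) (by
    rwa [Ne, Subgroup.map_eq_bot_iff_of_injective _ (Subgroup.subtype_injective _)]) (by
    rintro g hg _ ⟨n, hn, rfl⟩
    exact ⟨_, hM.conj_mem n hn ⟨g, hg⟩, rfl⟩)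
  rw [eq_top_iff]
  intro g _
  obtain ⟨g', hg', he⟩ := h g.2
  rwa [← Subtype.ext he]

end Building.LegalColouring

/-! ### Infinite dihedral local actions -/

/-- With X identified with ℤ through the orbit of `a₀` under Z, the group Y acts by all maps n ↦ i ±
n. Parity of the index is respected by these, and two indices of equal parity are swapped by the
reflection at their midpoint. -/
theorem Subgroup.IsInfiniteDihedralAction.exists_parity {X : Type w}
    {Y : Subgroup (Equiv.Perm X)} (hY : Y.IsInfiniteDihedralAction) (a₀ : X) :
    ¬ Y.ActsFreely ∧ ∃ par : X → ZMod 2, par a₀ = 0 ∧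
      (∀ f ∈ Y, ∀ a, par (f a) = par (f a₀) + par a) ∧
      (∀ a b, par a = par b → ∃ f ∈ Y, (∃ m, f m = m) ∧ f a = b) ∧
      ∃ f ∈ Y, par (f a₀) = 1 := by
  obtain ⟨-, Z, hcyc, hinf, hreg, hZY, hindex⟩ := hY
  obtain ⟨⟨z, hzZ⟩, hz⟩ := hcyc.exists_generator
  have hZ : ∀ f ∈ Z, ∃ i : ℤ, f = z ^ i := by
    intro f hf
    obtain ⟨i, hi⟩ := Subgroup.mem_zpowers_iff.1 (hz ⟨f, hf⟩)
    exact ⟨i, congrArg Subtype.val hi.symm⟩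
  have hzi : ∀ i : ℤ, z ^ i ∈ Z := fun i => zpow_mem hzZ i
  have huniq : ∀ f ∈ Z, ∀ g ∈ Z, f a₀ = g a₀ → f = g := by
    intro f hf g hg h
    exact congrArg Subtype.val
      ((hreg a₀ (g a₀)).unique (y₁ := (⟨f, hf⟩ : Z)) (y₂ := ⟨g, hg⟩) h rfl)
  have hinj : ∀ i j : ℤ, z ^ i = z ^ j → i = j := by
    have h1 : Function.Injective fun n : ℤ => (⟨z, hzZ⟩ : Z) ^ n := by
      rw [injective_zpow_iff_not_isOfFinOrder]
      intro hfin
      have h2 : (Subgroup.zpowers (⟨z, hzZ⟩ : Z) : Set Z).Finite := finite_zpowers.2 hfin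
      exact Set.infinite_univ (h2.subset fun x _ => hz x)
    intro i j h
    exact h1 (Subtype.ext h)
  have hidx : ∀ a, ∃ i : ℤ, (z ^ i) a₀ = a := by
    intro a
    obtain ⟨f, hf, -⟩ := hreg a₀ a
    obtain ⟨i, hi⟩ := hZ f.1 f.2
    exact ⟨i, by rw [← hi]; exact hf⟩
  choose idx hidx using hidx
  have hidx' : ∀ i : ℤ, idx ((z ^ i) a₀) = i := fun i =>
    hinj _ _ (huniq _ (hzi _) _ (hzi _) (hidx _))
  have hindex' : (Z.subgroupOf Y).index = 2 := hindex
  have hnormal := Subgroup.normal_of_index_eq_two hindex'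
  have hmul : ∀ f ∈ Y, ∀ g ∈ Y, (f * g ∈ Z ↔ (f ∈ Z ↔ g ∈ Z)) := fun f hf g hg =>
    Subgroup.mul_mem_iff_of_index_two hindex' (a := ⟨f, hf⟩) (b := ⟨g, hg⟩)
  obtain ⟨τ, hτ, hτZ⟩ : ∃ τ ∈ Y, τ ∉ Z := by
    by_contra! h
    have h1 : Z.relIndex Y = 1 := Subgroup.relIndex_eq_one.2 h
    lia
  obtain ⟨ς, hς, hςZ, hς0⟩ : ∃ ς ∈ Y, ς ∉ Z ∧ ς a₀ = a₀ := by
    refine ⟨(z ^ idx (τ a₀))⁻¹ * τ, mul_mem (inv_mem (hZY (hzi _))) hτ, ?_, ?_⟩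
    · rw [hmul _ (inv_mem (hZY (hzi _))) _ hτ]
      exact fun h => hτZ (h.1 (inv_mem (hzi _)))
    · rw [Equiv.Perm.mul_apply, Equiv.Perm.inv_eq_iff_eq, hidx]
  have hconj : ∀ g ∈ Y, g * z * g⁻¹ ∈ Z := fun g hg =>
    hnormal.conj_mem ⟨z, hZY hzZ⟩ hzZ ⟨g, hg⟩
  -- Conjugation by ς sends z to z^e with e = ±1. If e = 1, then ς commutes with the transitive
  -- group Z and fixes `a₀`, so ς = 1, contradicting ς ∉ Z.
  have hinv : ς * z * ς⁻¹ = z⁻¹ := by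
    obtain ⟨e, he⟩ := hZ _ (hconj ς hς)
    obtain ⟨e', he'⟩ := hZ _ (hconj ς⁻¹ (inv_mem hς))
    have h1 : z ^ (e * e') = z ^ (1 : ℤ) := by
      rw [zpow_mul, ← he, conj_zpow, ← he']
      group
    have h2 := hinj _ _ h1
    rcases Int.eq_one_or_neg_one_of_mul_eq_one h2 with h3 | h3
    · exfalso
      refine hςZ ?_
      have h4 : ς = 1 := by
        ext a
        rw [← hidx a]
        have h5 : ς * z ^ idx a = z ^ idx a * ς := by
          rw [h3, zpow_one, mul_inv_eq_iff_eq_mul] at he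
          exact (show Commute ς z from he).zpow_right _
        have h6 := congrArg (fun g => g a₀) h5
        simpa [hς0] using h6
      rw [h4]; exact one_mem _
    · rw [he, h3, zpow_neg_one]
  have hςz : ∀ k : ℤ, ς ((z ^ k) a₀) = (z ^ (-k)) a₀ := by
    intro k
    have h1 : ς * z ^ k = z ^ (-k) * ς := by
      rw [← mul_inv_eq_iff_eq_mul, ← conj_zpow, hinv, inv_zpow, zpow_neg]
    have h2 := congrArg (fun g => g a₀) h1
    simpa [hς0] using h2
  refine ⟨fun h => hςZ (by rw [h ς hς a₀ hς0]; exact one_mem _),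
    fun a => (idx a : ZMod 2), ?_, ?_, ?_, ?_⟩
  · have := hidx' 0
    rw [zpow_zero, Equiv.Perm.one_apply] at this
    simp [this]
  · intro f hf a
    by_cases hfZ : f ∈ Z
    · obtain ⟨i, rfl⟩ := hZ f hfZ
      dsimp only
      rw [hidx', ← hidx a, ← Equiv.Perm.mul_apply, ← zpow_add, hidx', hidx']
      push_cast; rfl
    · have h1 : f * ς⁻¹ ∈ Z := (hmul _ hf _ (inv_mem hς)).2
        (iff_of_false hfZ (mt inv_mem_iff.1 hςZ))
      obtain ⟨i, hi⟩ := hZ _ h1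
      have h2 : f = z ^ i * ς := by rw [← hi]; group
      dsimp only
      rw [h2, ← hidx a, Equiv.Perm.mul_apply, Equiv.Perm.mul_apply, hς0, hςz,
        ← Equiv.Perm.mul_apply, ← zpow_add, hidx', hidx', hidx']
      push_cast
      rw [ZMod.neg_eq_self_mod_two]
  · intro a b hab
    dsimp only at hab
    rw [ZMod.intCast_eq_intCast_iff_dvd_sub] at hab
    obtain ⟨m, hm⟩ := hab
    -- The reflection at index `idx a + m`, the midpoint because the indices of a and b differ by
    -- 2m.
    refine ⟨z ^ (idx a + m) * ς * (z ^ (idx a + m))⁻¹,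
      mul_mem (mul_mem (hZY (hzi _)) hς) (inv_mem (hZY (hzi _))), ⟨(z ^ (idx a + m)) a₀, ?_⟩, ?_⟩
    · rw [Equiv.Perm.mul_apply, Equiv.Perm.inv_eq_iff_eq.2 rfl, Equiv.Perm.mul_apply, hς0]
    · nth_rw 3 [← hidx a]
      rw [← hidx b, ← zpow_neg, Equiv.Perm.mul_apply, Equiv.Perm.mul_apply,
        ← Equiv.Perm.mul_apply (z ^ _) (z ^ idx a), ← zpow_add, hςz, ← Equiv.Perm.mul_apply, ← zpow_add]
      congr 2
      push_cast at hm
      lia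
  · refine ⟨z, hZY hzZ, ?_⟩
    have := hidx' 1
    rw [zpow_one] at this
    simp [this]

/-! ### The quotient by the subgroup generated by the chamber stabilizers -/

namespace SimpleGraph

variable {S : Type v} (Γ : SimpleGraph S)

local notation "σ" => CoxeterMatrix.simple (SimpleGraph.coxeterMatrix Γ)

/-- The parity of the number of occurrences of the letter `s`, as an element of `ZMod 2`. -/
noncomputable def parity (s : S) (w : Γ.coxeterMatrix.Group) : ZMod 2 :=
  Multiplicative.toAdd (Γ.letterParity s w)

theorem parity_one (s : S) : Γ.parity s 1 = 0 := by simp [parity]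

theorem parity_mul_self (s : S) (w : Γ.coxeterMatrix.Group) :
    Γ.parity s (w * σ s) = Γ.parity s w + 1 := by
  rw [parity, map_mul, letterParity_self]; rfl

theorem parity_mul_of_ne {s t : S} (h : t ≠ s) (w : Γ.coxeterMatrix.Group) :
    Γ.parity s (w * σ t) = Γ.parity s w := by
  rw [parity, map_mul, Γ.letterParity_of_ne h, mul_one]; rfl

open Classical in
/-- Multiplication on the right by `s`, if necessary, to reach a given parity. -/
noncomputable def parityMove (s : S) (e : ZMod 2) (w : Γ.coxeterMatrix.Group) :
    Γ.coxeterMatrix.Group :=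
  if Γ.parity s w = e then w else w * σ s

theorem parityMove_of_eq {s : S} {e : ZMod 2} {w : Γ.coxeterMatrix.Group}
    (h : Γ.parity s w = e) : Γ.parityMove s e w = w := if_pos h

theorem parityMove_of_ne {s : S} {e : ZMod 2} {w : Γ.coxeterMatrix.Group}
    (h : Γ.parity s w ≠ e) : Γ.parityMove s e w = w * σ s := if_neg h

theorem parityMove_eq_self_iff {s : S} {e : ZMod 2} {w : Γ.coxeterMatrix.Group} :
    Γ.parityMove s e w = w ↔ Γ.parity s w = e := by
  refine ⟨fun h => ?_, Γ.parityMove_of_eq⟩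
  by_contra hne
  rw [Γ.parityMove_of_ne hne, mul_eq_left] at h
  exact Γ.coxeterMatrix.simple_ne_one s h

theorem parity_parityMove_of_ne {s t : S} (h : t ≠ s) (e : ZMod 2) (w : Γ.coxeterMatrix.Group) :
    Γ.parity s (Γ.parityMove t e w) = Γ.parity s w := by
  by_cases h1 : Γ.parity t w = e
  · rw [Γ.parityMove_of_eq h1]
  · rw [Γ.parityMove_of_ne h1, Γ.parity_mul_of_ne h]

theorem parityMove_parityMove (s : S) (e e' : ZMod 2) (w : Γ.coxeterMatrix.Group) :
    Γ.parityMove s e (Γ.parityMove s e' w) = Γ.parityMove s e w := by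
  have key : ∀ x y z : ZMod 2, x ≠ y → (x + 1 = z ↔ x ≠ z) := by decide
  by_cases h1 : Γ.parity s w = e'
  · rw [Γ.parityMove_of_eq h1]
  · rw [Γ.parityMove_of_ne h1]
    have h2 := key _ _ e h1
    rw [← parity_mul_self] at h2
    by_cases h3 : Γ.parity s w = e
    · rw [Γ.parityMove_of_eq h3, Γ.parityMove_of_ne (fun h => h2.1 h h3),
        CoxeterMatrix.simple_mul_cancel_right]
    · rw [Γ.parityMove_of_ne h3, Γ.parityMove_of_eq (h2.2 h3)]

theorem parityMove_comm {s t : S} (h : Γ.Adj s t) (e e' : ZMod 2) (w : Γ.coxeterMatrix.Group) :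
    Γ.parityMove s e (Γ.parityMove t e' w) = Γ.parityMove t e' (Γ.parityMove s e w) := by
  have h1 := Γ.parity_parityMove_of_ne h.symm.ne e' w
  have h2 := Γ.parity_parityMove_of_ne h.ne e w
  by_cases hs : Γ.parity s w = e <;> by_cases ht : Γ.parity t w = e'
  · rw [Γ.parityMove_of_eq ht, Γ.parityMove_of_eq hs, Γ.parityMove_of_eq ht]
  · rw [Γ.parityMove_of_eq (h1.trans hs), Γ.parityMove_of_eq hs]
  · rw [Γ.parityMove_of_eq ht, Γ.parityMove_of_eq (h2.trans ht)]
  · rw [Γ.parityMove_of_ne (h1.trans_ne hs), Γ.parityMove_of_ne (h2.trans_ne ht),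
      Γ.parityMove_of_ne hs, Γ.parityMove_of_ne ht, mul_assoc, mul_assoc, Γ.simple_comm h]

end SimpleGraph

/-! ### The folding and the quotient group. -/

namespace Building.LegalColouring

variable {S : Type v} {Γ : SimpleGraph S} {C : Type u} {B : Building Γ.coxeterMatrix C}
  {Ω : S → Type w} (col : B.LegalColouring Ω) {F : ∀ s : S, Subgroup (Equiv.Perm (Ω s))}

local notation "σ" => CoxeterMatrix.simple (SimpleGraph.coxeterMatrix Γ)

/-- A parity function on the colours folds the building onto the right-angled Coxeter group. -/
theorem exists_folding (par : ∀ s, Ω s → ZMod 2) (c : C)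
    (hc : ∀ s, par s (col.colour s c) = 0) : ∃ ρ : C → Γ.coxeterMatrix.Group, ρ c = 1 ∧
      ∀ s x y, y ∈ B.panel s x →
        (par s (col.colour s y) = par s (col.colour s x) → ρ y = ρ x) ∧
        (par s (col.colour s y) ≠ par s (col.colour s x) → ρ y = ρ x * σ s) := by
  obtain ⟨ρ, h1, h2, h3⟩ := B.exists_developing_map col.colour col.constant_on_panel
    (fun s a => Γ.parityMove s (par s a)) (fun s _ _ => Γ.parityMove_parityMove s _ _)
    (fun s t hst _ _ => Γ.parityMove_comm hst _ _)
    (fun s t hst a b y hy => by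
      rw [SimpleGraph.parityMove_eq_self_iff] at hy ⊢
      rwa [Γ.parity_parityMove_of_ne hst]) c 1
    (fun s => Γ.parityMove_of_eq (by rw [hc, SimpleGraph.parity_one]))
  refine ⟨ρ, h1, fun s x y hy => ⟨fun h => ?_, fun h => ?_⟩⟩
  · rw [h3 s x y hy, h]
    exact h2 s x
  · have h4 := Γ.parityMove_eq_self_iff.1 (h2 s x)
    rw [h3 s x y hy]
    exact Γ.parityMove_of_ne (h4.trans_ne (Ne.symm h))

/-- If all local actions preserve parities of colours, and the colours of equal parity are
related by products of point stabilizers, then the quotient is the Coxeter group. -/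
theorem nonempty_quotient_mulEquiv (c : C) (par : ∀ s, Ω s → ZMod 2)
    (hc : ∀ s, par s (col.colour s c) = 0)
    (hpar : ∀ s, ∀ f ∈ F s, ∀ a, par s (f a) = par s (f (col.colour s c)) + par s a)
    (hstab : ∀ s a b, par s a = par s b → ∃ f ∈ F s, (∃ m, f m = m) ∧ f a = b)
    (hodd : ∀ s, ∃ f ∈ F s, par s (f (col.colour s c)) = 1) :
    Nonempty (col.universalGroup F ⧸ col.plus F ≃* Γ.coxeterMatrix.Group) := by
  obtain ⟨ρ, hρc, hρ⟩ := col.exists_folding par c hc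
  have hρg : ∀ (g : col.universalGroup F) (x : C), ρ (g • x) = ρ (g • c) * ρ x := by
    intro g x
    refine B.adj_induction (P := fun x => ρ (g • x) = ρ (g • c) * ρ x) c (by rw [hρc, mul_one])
      ?_ x
    intro s x y hxy ih
    have hy := B.mem_panel_of_δ_eq hxy
    have hgy : g • y ∈ B.panel s (g • x) := (B.smul_mem_panel_iff g.1 s x y).2 hy
    have e : ∀ z ∈ B.panel s x, par s (col.colour s (g • z)) =
        par s (col.localAction g.1 s x (col.colour s c)) + par s (col.colour s z) := by
      intro z hz
      rw [← hpar s _ (g.2 s x), col.localAction_colour g.1 s x z hz]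
      rfl
    have ex := e x (B.self_mem_panel s x)
    have ey := e y hy
    obtain ⟨h1, h2⟩ := hρ s x y hy
    obtain ⟨k1, k2⟩ := hρ s _ _ hgy
    by_cases h : par s (col.colour s y) = par s (col.colour s x)
    · rw [h1 h, k1 (by rw [ey, ex, h]), ih]
    · rw [h2 h, k2 (by rw [ey, ex]; exact fun h' => h (add_left_cancel h')), ih, mul_assoc]
  let φ : col.universalGroup F →* Γ.coxeterMatrix.Group :=
    MonoidHom.mk' (fun g => ρ (g • c)) fun g h => by rw [mul_smul]; exact hρg g _
  have hφ : col.plus F ≤ φ.ker := by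
    refine iSup_le fun x g hg => ?_
    have h := hρg g x
    rw [MulAction.mem_stabilizer_iff.1 hg] at h
    exact mul_eq_right.1 h.symm
  -- A local permutation with a fixed point is realized by an element fixing a chamber of the panel,
  -- so even changes of colour are achieved within U(F)⁺.
  have heven : ∀ s, ∀ y ∈ B.panel s c, par s (col.colour s y) = 0 →
      ∃ k ∈ col.plus F, k • c = y := by
    intro s y hy hy0
    obtain ⟨f, hf, ⟨m, hm⟩, hfy⟩ := hstab s (col.colour s c) (col.colour s y) (by rw [hc, hy0])
    obtain ⟨k, hk, hk1, hk2, -⟩ := col.exists_of_perm (F := F) hf (c := col.move s m c)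
      (d := col.move s m c) (by rw [colour_move, hm]) (fun _ _ => rfl)
    refine ⟨⟨k, hk⟩, col.mem_plus_of_fixes hk1, ?_⟩
    have h1 := (B.smul_mem_panel_iff k s _ _).2 (B.mem_panel_symm (col.move_mem s m c))
    rw [hk1] at h1
    exact (col.bijOn_panel s c).injOn (B.mem_panel_trans (col.move_mem s m c) h1) hy
      ((hk2 c).trans hfy)
  choose f hf hf1 using hodd
  have hg := fun s => col.exists_of_perm (F := F) (hf s) (c := c)
    (d := col.move s (f s (col.colour s c)) c) (by rw [colour_move])
    (fun t ht => col.colour_move_of_ne ht.symm _ _)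
  choose g hgU hgc hgs hgt using hg
  let G : S → col.universalGroup F := fun s => ⟨g s, hgU s⟩
  have hGpar : ∀ s (x : C), par s (col.colour s (G s • x)) = 1 + par s (col.colour s x) := by
    intro s x
    rw [← hf1 s, ← hpar s _ (hf s), ← hgs]
    rfl
  have hGpanel : ∀ s x, x ∈ B.panel s c ↔ G s • x ∈ B.panel s c := by
    intro s x
    have h1 : G s • c ∈ B.panel s c := by
      change g s • c ∈ B.panel s c
      rw [hgc]; exact col.move_mem _ _ _
    rw [← B.smul_mem_panel_iff (g s) s c x]
    exact ⟨fun h => B.mem_panel_trans h1 h, fun h => B.mem_panel_trans (B.mem_panel_symm h1) h⟩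
  have hsq : ∀ s, G s * G s ∈ col.plus F := by
    intro s
    obtain ⟨k, hk, hkc⟩ := heven s (G s • G s • c)
      ((hGpanel s _).1 ((hGpanel s _).1 (B.self_mem_panel s c))) (by
        rw [hGpar, hGpar, hc]; decide)
    have h1 : k⁻¹ * (G s * G s) ∈ col.plus F :=
      col.mem_plus_of_fixes (c := c) (by rw [mul_smul, mul_smul, ← hkc, inv_smul_smul])
    have h2 := mul_mem hk h1
    rwa [mul_inv_cancel_left] at h2
  have hcomm : ∀ s t, Γ.Adj s t → G s * G t = G t * G s := by
    have key : ∀ s t, s ≠ t → (g s * g t) • c = col.move t (f t (col.colour t c))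
        (col.move s (f s (col.colour s c)) c) := by
      intro s t hst
      rw [mul_smul, hgc]
      refine col.eq_move ?_ ?_
      · rw [← hgc, smul_mem_panel_iff]; exact col.move_mem _ _ _
      · rw [hgt s t hst.symm, colour_move]
    intro s t hst
    refine Subtype.ext (col.aut_ext (c := c) ?_ fun r x => ?_)
    · change (g s * g t) • c = (g t * g s) • c
      rw [key s t hst.ne, key t s hst.symm.ne, col.move_comm hst]
    · change col.colour r ((g s * g t) • x) = col.colour r ((g t * g s) • x)
      rw [mul_smul, mul_smul]
      by_cases hrs : r = s
      · subst hrs; rw [hgs, hgt t r hst.ne, hgt t r hst.ne, hgs]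
      by_cases hrt : r = t
      · subst hrt; rw [hgs, hgt s r hrs, hgt s r hrs, hgs]
      rw [hgt s r hrs, hgt t r hrt, hgt t r hrt, hgt s r hrs]
  -- The lifts `G s` satisfy the commutation relations exactly, but are involutions only modulo
  -- U(F)⁺. The map induced by `φ` is a left inverse of ψ.
  let ψ : Γ.coxeterMatrix.Group →* col.universalGroup F ⧸ col.plus F :=
    Γ.liftHom (fun s => QuotientGroup.mk' (col.plus F) (G s))
      (fun s => by rw [← map_mul]; exact (QuotientGroup.eq_one_iff _).2 (hsq s))
      (fun s t hst => by rw [← map_mul, ← map_mul, hcomm s t hst])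
  have hψ : ∀ s, ψ (σ s) = QuotientGroup.mk' (col.plus F) (G s) := Γ.liftHom_simple _ _ _
  have hinj : Function.Injective ψ := by
    have h1 : (QuotientGroup.lift (col.plus F) φ hφ).comp ψ = MonoidHom.id _ := by
      refine Γ.cs.ext_simple fun s => ?_
      change QuotientGroup.lift (col.plus F) φ hφ (ψ (σ s)) = σ s
      rw [hψ]
      change ρ (G s • c) = σ s
      rw [(hρ s c _ ((hGpanel s c).1 (B.self_mem_panel s c))).2 (by rw [hGpar, hc]; decide), hρc,
        one_mul]
    exact Function.LeftInverse.injective (g := QuotientGroup.lift (col.plus F) φ hφ)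
      fun w => DFunLike.congr_fun h1 w
  have hsurj : Function.Surjective ψ := by
    -- The preimage of the image of ψ contains all chamber stabilizers, so transitivity on chambers
    -- makes it the whole group.
    let R : Subgroup (col.universalGroup F) := ψ.range.comap (QuotientGroup.mk' (col.plus F))
    have hR : col.plus F ≤ R := by
      intro k hk
      rw [Subgroup.mem_comap, QuotientGroup.mk'_apply, (QuotientGroup.eq_one_iff k).2 hk]
      exact one_mem _
    have hRG : ∀ s, G s ∈ R := fun s => ⟨σ s, hψ s⟩
    have hpanel : ∀ s, ∀ y ∈ B.panel s c, ∃ k ∈ R, k • c = y := by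
      intro s y hy
      by_cases h0 : par s (col.colour s y) = 0
      · obtain ⟨k, hk, hkc⟩ := heven s y hy h0
        exact ⟨k, hR hk, hkc⟩
      · have h1 := hGpar s ((G s)⁻¹ • y)
        have h2 := hGpanel s ((G s)⁻¹ • y)
        rw [smul_inv_smul] at h1 h2
        have key : ∀ a b : ZMod 2, a ≠ 0 → a = 1 + b → b = 0 := by decide
        obtain ⟨k, hk, hkc⟩ := heven s _ (h2.2 hy) (key _ _ h0 h1)
        exact ⟨G s * k, mul_mem (hRG s) (hR hk), by rw [mul_smul, hkc, smul_inv_smul]⟩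
    have htrans : ∀ x, ∃ k ∈ R, k • c = x := by
      refine B.adj_induction c ⟨1, one_mem _, one_smul _ _⟩ ?_
      rintro s _ y hxy ⟨h, hh, rfl⟩
      obtain ⟨k, hk, hkc⟩ := hpanel s (h⁻¹ • y) (by
        rw [← B.smul_mem_panel_iff h.1 s]
        change h • h⁻¹ • y ∈ _
        rw [smul_inv_smul]
        exact B.mem_panel_of_δ_eq hxy)
      exact ⟨h * k, mul_mem hh hk, by rw [mul_smul, hkc, smul_inv_smul]⟩
    intro q
    obtain ⟨u, rfl⟩ := QuotientGroup.mk'_surjective (col.plus F) q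
    obtain ⟨k, hk, hkc⟩ := htrans (u • c)
    have h1 : k⁻¹ * u ∈ col.plus F :=
      col.mem_plus_of_fixes (c := c) (by rw [mul_smul, ← hkc, inv_smul_smul])
    have h2 := mul_mem hk (hR h1)
    rw [mul_inv_cancel_left] at h2
    exact h2
  exact ⟨(MulEquiv.ofBijective ψ ⟨hinj, hsurj⟩).symm⟩

end Building.LegalColouring

/-! ### The main theorem. -/

theorem theoremA {S : Type v} [Finite S] [Nontrivial S] (Γ : SimpleGraph S)
    (hΓ : Γᶜ.Connected) {C : Type u} (B : Building Γ.coxeterMatrix C)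
    {Ω : S → Type w} (col : B.LegalColouring Ω) (F : ∀ s : S, Subgroup (Equiv.Perm (Ω s))) :
    col.plus F = col.ddagger F ∧
    ((¬ ∀ s : S, (F s).ActsFreely) →
      IsMonolithic (col.universalGroup F) ∧
      monolith (col.universalGroup F) = col.plus F ∧
      IsSimpleGroup (col.plus F)) ∧
    ((∀ s : S, (F s).IsInfiniteDihedralAction) →
      IsMonolithic (col.universalGroup F) ∧
      monolith (col.universalGroup F) = col.plus F ∧
      IsSimpleGroup (col.plus F) ∧
      Nonempty (col.universalGroup F ⧸ col.plus F ≃* Γ.coxeterMatrix.Group)) := by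
  refine ⟨col.plus_eq_ddagger F hΓ, fun h => ?_, fun h => ?_⟩
  · obtain ⟨s, hs⟩ := not_forall.1 h
    exact ⟨col.isMonolithic hΓ hs, col.monolith_eq_plus hΓ hs, col.isSimpleGroup_plus hΓ hs⟩
  · obtain ⟨c⟩ := B.nonempty
    have hpar := fun s => (h s).exists_parity (col.colour s c)
    obtain ⟨s⟩ : Nonempty S := inferInstance
    have hs := (hpar s).1
    choose par h1 h2 h3 h4 using fun s => (hpar s).2
    exact ⟨col.isMonolithic hΓ hs, col.monolith_eq_plus hΓ hs, col.isSimpleGroup_plus hΓ hs,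
      col.nonempty_quotient_mulEquiv c par h1 h2 h3 h4⟩
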